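/- **Notation.** For $\gamma\in(0,\frac{\pi}{2})$ let $B_\gamma\subset\mathbb{C}$ be the interior of the convex hull of the point $1$ and the open disc $D(0,\sin\gamma)$. Let $X$ be a complex Banach space, let $B(X)$ be the algebra of bounded operators on $X$, and for $T\in B(X)$ write $R(\lambda,T)=(\lambda I-T)^{-1}$ for $\lambda\notin\sigma(T)$. Let $(\varepsilon_k)_{k\ge 1}$ be a sequence of independent Rademacher variables on a probability space $(\mathcal M,\mathbb P)$; for a series $\sum_k\varepsilon_k\otimes x_k$ with $x_k\in X$ that converges in $L^2(\mathcal M;X)$ let $\|\sum_k\varepsilon_k\otimes x_k\|_{\mathrm{Rad}(X)}$ be the $L^2(\mathcal M;X)$-norm of its sum. * A set $E\subset B(X)$ is $R$-bounded if there is a constant $C\ge 0$ such that $\|\sum_k\varepsilon_k\otimes T_kx_k\|_{\mathrm{Rad}(X)}\le C\,\|\sum_k\varepsilon_k\otimes x_k\|_{\mathrm{Rad}(X)}$ for all finite families $(T_k)$ in $E$ and $(x_k)$ in $X$. * $T\in B(X)$ is an $R$-Ritt operator of $R$-type $\alpha\in(0,\frac{\pi}{2})$ if $\sigma(T)\subset\overline{B_\alpha}$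 and, for every $\beta\in(\alpha,\frac{\pi}{2})$, the set $\{(\lambda-1)R(\lambda,T):\lambda\in\mathbb{C}\setminus\overline{B_\beta}\}$ is $R$-bounded. * For $T\in B(X)$ and $x\in X$ put $$\|x\|_{T,1}=\Bigl\|\sum_{k=1}^\infty k^{1/2}\,\varepsilon_k\otimes T^{k-1}(I-T)x\Bigr\|_{\mathrm{Rad}(X)}$$ if this series converges in $L^2(\mathcal M;X)$, and $\|x\|_{T,1}=\infty$ otherwise. For the adjoint $T^*\in B(X^*)$ on the dual space, $\|y\|_{T^*,1}$ is defined in the same way for $y\in X^*$. * $H^\infty_0(B_\gamma)$ is the space of bounded holomorphic functions $\varphi\colon B_\gamma\to\mathbb{C}$ for which there are $s,c>0$ with $|\varphi(\lambda)|\le c\,|1-\lambda|^s$ on $B_\gamma$, and $\|\varphi\|_{\infty,B_\gamma}=\sup_{\lambda\in B_\gamma}|\varphi(\lambda)|$. * If $T$ is an $R$-Ritt operator of $R$-type $\alpha$, $\gamma\in(\alpha,\frac{\pi}{2})$ and $\varphi\in H^\infty_0(B_\gamma)$, then $$\varphi(T)=\frac{1}{2\pi i}\int_{\partial B_\beta}\varphi(\lambda)R(\lambda,T)\,d\lambda,\qquad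 \beta\in(\alpha,\gamma),$$ where $\partial B_\beta$ is oriented counterclockwise; the integral converges absolutely and does not depend on the choice of $\beta$. One says that $T$ admits a bounded $H^\infty(B_\gamma)$ functional calculus if there is a constant $K>0$ such that $\|\varphi(T)\|\le K\|\varphi\|_{\infty,B_\gamma}$ for all $\varphi\in H^\infty_0(B_\gamma)$. **Theorem.** Let $T$ be an $R$-Ritt operator of $R$-type $\alpha\in(0,\frac{\pi}{2})$ on an arbitrary complex Banach space $X$. Suppose that there is a constant $C\ge 0$ such that $$\|x\|_{T,1}\le C\|x\|\quad\text{for all }x\in X\qquad\text{and}\qquad \|y\|_{T^*,1}\le C\|y\|\quad\text{for all }y\in X^*.$$ Then $T$ admits a bounded $H^\infty(B_\gamma)$ functional calculus for every $\gamma\in(\alpha,\frac{\pi}{2})$. -/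

import Mathlib

namespace RittCalc

noncomputable section

open MeasureTheory Filter Topology
open scoped NNReal ENNReal

/-! ### Rademacher averages -/

/-- The sample space `{±1}^ℕ` (`true` encodes `1`, `false` encodes `-1`). -/
abbrev SignSpace : Type := ℕ → Bool

/-- The product of the uniform probability measures on the factors of the sample space. -/
def signMeasure : Measure SignSpace :=
  Measure.infinitePi (fun _ : ℕ => (PMF.uniformOfFintype Bool).toMeasure)

/-- The independent Rademacher variables: the coordinate signs. The variable with index `k`
here is the `(k+1)`-st one of a sequence that is numbered from `1`. -/
def rademacher (k : ℕ) (u : SignSpace) : ℝ := if u k then 1 else -1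

variable {X : Type*} [NormedAddCommGroup X] [NormedSpace ℂ X]

/-- The random vector `∑_{k < n} ε_k ⊗ x_k`. -/
def radSum (x : ℕ → X) (n : ℕ) (u : SignSpace) : X :=
  ∑ k ∈ Finset.range n, rademacher k u • x k

/-- The `Rad(X)`-norm of the finite sum `∑_{k < n} ε_k ⊗ x_k`, that is, its `L²`-norm. -/
def radNorm (x : ℕ → X) (n : ℕ) : ℝ≥0∞ := eLpNorm (radSum x n) 2 signMeasure

/-- The series `∑_k ε_k ⊗ x_k` converges in the Bochner space `L²(X)`, with sum `f`. -/
def HasRadSum (x : ℕ → X) (f : SignSpace → X) : Prop :=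
  MemLp f 2 signMeasure ∧
    Tendsto (fun n : ℕ => eLpNorm (radSum x n - f) 2 signMeasure) atTop (𝓝 0)

/-- The `Rad(X)`-norm of the series `∑_k ε_k ⊗ x_k`: the `L²`-norm of its sum if the series
converges in `L²(X)` (the sum is then unique almost everywhere), and `∞` otherwise (the
infimum of the empty family). -/
def radSeriesNorm (x : ℕ → X) : ℝ≥0∞ :=
  ⨅ (f : SignSpace → X) (_ : HasRadSum x f), eLpNorm f 2 signMeasure

/-- The square function
`‖x‖_{T,m} = ‖∑_{k ≥ 1} k^{m-1/2} ε_k ⊗ T^{k-1} (I - T)^m x‖_{Rad(X)}`, with `k` shifted by one. -/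
def squareFunction (T : X →L[ℂ] X) (m : ℕ) (x : X) : ℝ≥0∞ :=
  radSeriesNorm fun k : ℕ =>
    ((k : ℝ) + 1) ^ ((m : ℝ) - 1 / 2) • ((T ^ k * (1 - T) ^ m : X →L[ℂ] X) x)

/-- The uniform square function estimate `‖x‖_{T,m} ≲ ‖x‖`. -/
def SquareFunctionEstimate (T : X →L[ℂ] X) (m : ℕ) : Prop :=
  ∃ C : ℝ≥0, ∀ x : X, squareFunction T m x ≤ C * ‖x‖ₑ

/-- The (Banach space) adjoint `T* : X* → X*`, `y ↦ y ∘ T`. -/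
def dualOp (T : X →L[ℂ] X) : StrongDual ℂ X →L[ℂ] StrongDual ℂ X :=
  ContinuousLinearMap.precomp ℂ T

/-- `R`-boundedness of a set of bounded operators. -/
def IsRBounded (E : Set (X →L[ℂ] X)) : Prop :=
  ∃ C : ℝ≥0, ∀ (n : ℕ) (S : ℕ → X →L[ℂ] X) (x : ℕ → X), (∀ k < n, S k ∈ E) →
    radNorm (fun k => S k (x k)) n ≤ C * radNorm x n

/-! ### Stolz domains and `R`-Ritt operators -/

/-- The Stolz domain `B_γ`: the interior of the convex hull of `1` and of the disc
`D(0, sin γ)`. -/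
def stolz (γ : ℝ) : Set ℂ :=
  interior (convexHull ℝ ({1} ∪ Metric.ball (0 : ℂ) (Real.sin γ)))

/-- `T` is an `R`-Ritt operator of `R`-type `α`: the spectrum of `T` is contained in the closure
of `B_α` and, for every `β ∈ (α, π/2)`, the set of all `(λ - 1) R(λ, T)` with `λ` outside of the
closure of `B_β` is `R`-bounded. Here `resolvent T λ` is `R(λ, T) = (λ - T)⁻¹`. -/
def IsRRittOfRType (T : X →L[ℂ] X) (α : ℝ) : Prop :=
  spectrum ℂ T ⊆ closure (stolz α) ∧
    ∀ β ∈ Set.Ioo α (Real.pi / 2),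
      IsRBounded {S : X →L[ℂ] X | ∃ l : ℂ, l ∉ closure (stolz β) ∧ S = (l - 1) • resolvent T l}

/-! ### The functional calculus -/

/-- The class `H^∞_0(B_γ)`: bounded holomorphic functions `φ` on `B_γ` such that
`|φ(z)| ≤ c |1 - z|^s` on `B_γ` for some `s, c > 0`. Values outside of `B_γ` are irrelevant. -/
def IsHZero (γ : ℝ) (φ : ℂ → ℂ) : Prop :=
  DifferentiableOn ℂ φ (stolz γ) ∧
    (∃ M : ℝ, ∀ z ∈ stolz γ, ‖φ z‖ ≤ M) ∧
    ∃ s c : ℝ, 0 < s ∧ 0 < c ∧ ∀ z ∈ stolz γ, ‖φ z‖ ≤ c * ‖1 - z‖ ^ s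

/-- The norm `‖φ‖_{∞, B_γ}`. -/
def supNorm (γ : ℝ) (φ : ℂ → ℂ) : ℝ := ⨆ z : stolz γ, ‖φ z‖

/-- The point `sin β · e^{iθ}` of the circle that bounds the disc `D(0, sin β)`. -/
def circlePoint (β θ : ℝ) : ℂ := Real.sin β * Complex.exp (Complex.I * θ)

/-- The integral of `F` along the segment from `a` to `b`. -/
def segmentIntegral (a b : ℂ) (F : ℂ → X →L[ℂ] X) : X →L[ℂ] X :=
  ∫ t in (0 : ℝ)..1, (b - a) • F (a + t * (b - a))

/-- The integral of `F` along the boundary of `B_β`, oriented counterclockwise. This boundary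
consists of the segment from `1` to the tangent point `sin β · e^{i(π/2 - β)}`, of the arc of
circle from there to the tangent point `sin β · e^{-i(π/2 - β)}` through `-sin β`, and of the
segment from there to `1`. -/
def stolzBoundaryIntegral (β : ℝ) (F : ℂ → X →L[ℂ] X) : X →L[ℂ] X :=
  segmentIntegral 1 (circlePoint β (Real.pi / 2 - β)) F +
    (∫ θ in (Real.pi / 2 - β)..(3 * Real.pi / 2 + β),
      (Complex.I * circlePoint β θ) • F (circlePoint β θ)) +
    segmentIntegral (circlePoint β (3 * Real.pi / 2 + β)) 1 F

/-- The operator `φ(T) = (2πi)⁻¹ ∫_{∂B_β} φ(λ) R(λ, T) dλ`. For `T` of type `α`,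
`φ ∈ H^∞_0(B_γ)` and `α < β < γ` the integral converges absolutely and does not depend on `β`. -/
def hInfCalc (T : X →L[ℂ] X) (β : ℝ) (φ : ℂ → ℂ) : X →L[ℂ] X :=
  (2 * Real.pi * Complex.I : ℂ)⁻¹ •
    stolzBoundaryIntegral β fun l => φ l • resolvent T l

/-- The operator `T`, of type `α`, has a bounded `H^∞(B_γ)` functional calculus: there is `K > 0`
with `‖φ(T)‖ ≤ K ‖φ‖_{∞, B_γ}` for all `φ ∈ H^∞_0(B_γ)`. The operator `φ(T)` is computed with an
arbitrary `β ∈ (α, γ)`. -/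
def HasBoundedCalculus (T : X →L[ℂ] X) (α γ : ℝ) : Prop :=
  ∃ K : ℝ, 0 < K ∧ ∀ φ : ℂ → ℂ, IsHZero γ φ → ∀ β ∈ Set.Ioo α γ,
    ‖hInfCalc T β φ‖ ≤ K * supNorm γ φ

end

end RittCalc

/-!
The operator `φ(T)` is estimated by trace duality. From `∑ (n+2 choose 2) z ^ n = (1 - z)⁻³` one
gets polynomials `P_N(z) = ∑_{k<N} (k + 1) (z ^ k (1 - z))² w_k(z)`, where `w_k(z)` is a combination
of `z ^ (k + r) (1 - z)`, `r ≤ 2`, with coefficients of size `k + 1`; on `∂B_s` they are bounded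
and converge to `1` away from the vertex `1` (`eval_approxPoly`). As `φ` vanishes at the vertex,
dominated convergence yields `φ(T) P_N(T) → φ(T)` (`tendsto_hInfCalc_approxPoly`); no ergodic
decomposition of `X`, hence no reflexivity, is needed. On the other hand
`⟨y, φ(T) P_N(T) x⟩ = ∑_{k<N} ⟨y_k, U_k x_k⟩`, where `x_k = (k + 1)^(1/2) T^k (1 - T) x` and
`y_k = (k + 1)^(1/2) T*^k (1 - T*) y` are the vectors of the two square functions and
`U_k = φ(T) w_k(T)` (`apply_hInfCalc_approxPoly`). By orthogonality of the Rademacher variables and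
the Cauchy–Schwarz inequality (`enorm_sum_apply_le`) it remains to see that the `U_k` are
`R`-bounded with a constant that is proportional to `‖φ‖_∞`.

Now `U_k` is the integral over `∂B_s` of a scalar function bounded by
`18 ‖φ‖_∞ (k + 1) |z| ^ k` times the operator `(z - 1) R(z, T)`. The mass of
`(k + 1) |z| ^ k |dz|` is bounded in `k`, because `∂B_s` approaches the unit circle
non-tangentially. So every `U_k` is `‖φ‖_∞` times a combination, with constant coefficients, of
three elements of the closed absolutely convex hull of the `R`-bounded set of all
`(z - 1) R(z, T)` (`exists_stolzBoundaryIntegral_eq`), and passing to this hull only doubles the `R`-bound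
(`RBoundedBy.diskHull`, `RBoundedBy.closure_convexHull`).

The algebraic rules of the calculus and the independence of the contour both follow from one form
of Cauchy's theorem (`stolzBoundaryIntegral_congr`): the contours `∂B_s` form a smooth homotopy
with common vertex `1`, at which the integrands have an integrable singularity.
-/

namespace RittCalc

noncomputable section

open MeasureTheory Filter Topology
open scoped NNReal ENNReal

/-! ### Geometry of Stolz domains -/

theorem norm_circlePoint {s : ℝ} (h0 : 0 ≤ s) (h1 : s ≤ Real.pi) (θ : ℝ) :
    ‖circlePoint s θ‖ = Real.sin s := by
  have h : ‖Complex.exp (Complex.I * θ)‖ = 1 := by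
    rw [mul_comm]; exact Complex.norm_exp_ofReal_mul_I θ
  rw [circlePoint, norm_mul, h, mul_one, Complex.norm_real, Real.norm_of_nonneg]
  exact Real.sin_nonneg_of_nonneg_of_le_pi h0 h1

/-- The segment from `1` to a point of the open disc `D(0, sin γ)` lies in `B_γ`, except for `1`. -/
theorem segment_mem_stolz {γ : ℝ} {P : ℂ} (hP : ‖P‖ < Real.sin γ) {t : ℝ}
    (ht : 0 < t) (ht1 : t ≤ 1) : 1 + t * (P - 1) ∈ stolz γ := by
  have hP' : P ∈ stolz γ := by
    refine interior_mono (subset_convexHull ℝ _)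
      (interior_mono Set.subset_union_right ?_)
    rw [Metric.isOpen_ball.interior_eq]
    simpa using hP
  have h1 : (1 : ℂ) ∈ convexHull ℝ ({1} ∪ Metric.ball (0 : ℂ) (Real.sin γ)) :=
    subset_convexHull ℝ _ (by simp)
  have hK := convex_convexHull ℝ ({1} ∪ Metric.ball (0 : ℂ) (Real.sin γ))
  have := hK.combo_interior_self_mem_interior hP' h1 ht (sub_nonneg.2 ht1) (by ring)
  have e : 1 + t * (P - 1) = t • P + (1 - t) • (1 : ℂ) := by
    rw [Complex.real_smul, Complex.real_smul]
    push_cast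
    ring
  rwa [e]

theorem exists_of_mem_closure_stolz {β : ℝ} (hβ : 0 < Real.sin β) {z : ℂ}
    (hz : z ∈ closure (stolz β)) :
    ∃ t ∈ Set.Icc (0 : ℝ) 1, ∃ w : ℂ, ‖w‖ ≤ Real.sin β ∧ z = 1 + t * (w - 1) := by
  set K : Set ℂ := (fun p : ℝ × ℂ => 1 + (p.1 : ℂ) * (p.2 - 1)) ''
    (Set.Icc (0 : ℝ) 1 ×ˢ Metric.closedBall 0 (Real.sin β)) with hK
  have hc : IsClosed K :=
    ((isCompact_Icc.prod (isCompact_closedBall _ _)).image (by fun_prop)).isClosed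
  have hsub : stolz β ⊆ K := by
    refine interior_subset.trans ?_
    rw [Set.singleton_union, convexHull_insert (by simpa using hβ)]
    intro z hz
    rw [mem_convexJoin] at hz
    obtain ⟨a, ha, w, hw, hz⟩ := hz
    rw [(convex_ball _ _).convexHull_eq] at hw
    rw [segment_eq_image] at hz
    obtain ⟨t, ht, rfl⟩ := hz
    refine ⟨(t, w), ⟨ht, Metric.ball_subset_closedBall hw⟩, ?_⟩
    rw [Set.mem_singleton_iff.1 ha]
    simp only [Complex.real_smul]
    push_cast
    ring
  obtain ⟨⟨t, w⟩, ⟨ht, hw⟩, rfl⟩ := closure_minimal hsub hc hz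
  exact ⟨t, ht, w, by simpa using hw, rfl⟩

/-- The Stolz domain `B_β` lies strictly on one side of every line that is tangent to a larger
circle of radius `sin s` and does not separate `1` from the disc; only the point `1` of the
closure can lie on such a line. -/
theorem notMem_closure_stolz {β s θ : ℝ} (hβ : 0 < Real.sin β) (hs : Real.sin β < Real.sin s)
    (hθ : Real.cos θ ≤ Real.sin s) {z : ℂ} (hz1 : z ≠ 1)
    (hz : (Complex.exp (-(Complex.I * θ)) * z).re = Real.sin s) : z ∉ closure (stolz β) := by
  intro hmem
  obtain ⟨t, ht, w, hw, rfl⟩ := exists_of_mem_closure_stolz hβ hmem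
  have ht0 : 0 < t := by
    rcases ht.1.eq_or_lt with h | h
    · exact absurd (by simp [← h]) hz1
    · exact h
  have he : ‖Complex.exp (-(Complex.I * θ))‖ = 1 := by
    rw [show -(Complex.I * θ) = ((-θ : ℝ) : ℂ) * Complex.I by push_cast; ring]
    exact Complex.norm_exp_ofReal_mul_I _
  have hre : (Complex.exp (-(Complex.I * θ))).re = Real.cos θ := by
    rw [show -(Complex.I * θ) = ((-θ : ℝ) : ℂ) * Complex.I by push_cast; ring,
      Complex.exp_ofReal_mul_I_re, Real.cos_neg]
  have h1 : (Complex.exp (-(Complex.I * θ)) * w).re ≤ Real.sin β :=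
    (Complex.re_le_norm _).trans (by rw [norm_mul, he, one_mul]; exact hw)
  have h2 : Complex.exp (-(Complex.I * θ)) * (1 + t * (w - 1)) =
      ((1 - t : ℝ) : ℂ) * Complex.exp (-(Complex.I * θ))
        + (t : ℂ) * (Complex.exp (-(Complex.I * θ)) * w) := by push_cast; ring
  rw [h2, Complex.add_re, Complex.re_ofReal_mul, Complex.re_ofReal_mul, hre] at hz
  nlinarith [mul_le_mul_of_nonneg_left hθ (sub_nonneg.2 ht.2),
    mul_le_mul_of_nonneg_left h1 ht0.le, mul_lt_mul_of_pos_left hs ht0]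

/-- The boundary of `B_s` without the vertex `1`: two half-open segments and an arc. -/
def stolzContour (s : ℝ) : Set ℂ :=
  {z | ∃ t ∈ Set.Ioc (0 : ℝ) 1, z = 1 + t * (circlePoint s (Real.pi / 2 - s) - 1)} ∪
  {z | ∃ t ∈ Set.Ioc (0 : ℝ) 1, z = 1 + t * (circlePoint s (3 * Real.pi / 2 + s) - 1)} ∪
  {z | ∃ θ ∈ Set.Icc (Real.pi / 2 - s) (3 * Real.pi / 2 + s), z = circlePoint s θ}

theorem stolzContour_subset_stolz {s γ : ℝ} (hs : 0 ≤ s) (hsγ : s < γ) (hγ : γ < Real.pi / 2) :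
    stolzContour s ⊆ stolz γ := by
  have hsin : Real.sin s < Real.sin γ :=
    Real.sin_lt_sin_of_lt_of_le_pi_div_two (by linarith) hγ.le hsγ
  have hP : ∀ θ, ‖circlePoint s θ‖ < Real.sin γ := fun θ => by
    rwa [norm_circlePoint hs (by linarith [Real.pi_pos])]
  rintro z ((⟨t, ht, rfl⟩ | ⟨t, ht, rfl⟩) | ⟨θ, -, rfl⟩)
  · exact segment_mem_stolz (hP _) ht.1 ht.2
  · exact segment_mem_stolz (hP _) ht.1 ht.2
  · simpa using segment_mem_stolz (hP θ) one_pos le_rfl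

theorem re_rotate_circlePoint (s θ : ℝ) :
    (Complex.exp (-(Complex.I * θ)) * circlePoint s θ).re = Real.sin s := by
  rw [circlePoint, mul_left_comm, ← Complex.exp_add]
  simp [Complex.sin_ofReal_re]

theorem circlePoint_ne_one {s : ℝ} (hs : 0 ≤ s) (hs' : s < Real.pi / 2) (θ : ℝ) :
    circlePoint s θ ≠ 1 := by
  intro h
  have := norm_circlePoint hs (by linarith [Real.pi_pos]) θ
  rw [h, norm_one] at this
  have h2 := Real.sin_lt_sin_of_lt_of_le_pi_div_two (by linarith) le_rfl hs'
  rw [Real.sin_pi_div_two] at h2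
  linarith

theorem stolzContour_disjoint_closure {β s : ℝ} (hβ : 0 < β) (hβs : β < s)
    (hs : s < Real.pi / 2) {z : ℂ} (hz : z ∈ stolzContour s) : z ∉ closure (stolz β) := by
  have hpi := Real.pi_pos
  have hsin : Real.sin β < Real.sin s :=
    Real.sin_lt_sin_of_lt_of_le_pi_div_two (by linarith) hs.le hβs
  have hβ' : 0 < Real.sin β := Real.sin_pos_of_pos_of_lt_pi hβ (by linarith)
  have hseg : ∀ θ t : ℝ, Real.cos θ = Real.sin s → 0 < t →
      1 + t * (circlePoint s θ - 1) ∉ closure (stolz β) := by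
    intro θ t hθ ht
    refine notMem_closure_stolz hβ' hsin hθ.le ?_ ?_
    · intro h
      have h3 : (t : ℂ) * (circlePoint s θ - 1) = 0 := by simpa using h
      rcases mul_eq_zero.1 h3 with h4 | h4
      · exact ht.ne' (by exact_mod_cast h4)
      · exact circlePoint_ne_one (hβ.trans hβs).le hs θ (sub_eq_zero.1 h4)
    · have h2 : Complex.exp (-(Complex.I * θ)) * (1 + t * (circlePoint s θ - 1)) =
        ((1 - t : ℝ) : ℂ) * Complex.exp (-(Complex.I * θ))
          + (t : ℂ) * (Complex.exp (-(Complex.I * θ)) * circlePoint s θ) := by push_cast; ring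
      have hre : (Complex.exp (-(Complex.I * θ))).re = Real.cos θ := by
        rw [show -(Complex.I * θ) = ((-θ : ℝ) : ℂ) * Complex.I by push_cast; ring,
          Complex.exp_ofReal_mul_I_re, Real.cos_neg]
      rw [h2, Complex.add_re, Complex.re_ofReal_mul, Complex.re_ofReal_mul, hre,
        re_rotate_circlePoint, hθ]
      ring
  rcases hz with (⟨t, ht, rfl⟩ | ⟨t, ht, rfl⟩) | ⟨θ, hθ, rfl⟩
  · exact hseg _ t (Real.cos_pi_div_two_sub s) ht.1
  · refine hseg _ t ?_ ht.1
    rw [show 3 * Real.pi / 2 + s = (s + Real.pi / 2) + Real.pi by ring, Real.cos_add_pi,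
      Real.cos_add_pi_div_two, neg_neg]
  · refine notMem_closure_stolz hβ' hsin ?_ (circlePoint_ne_one (hβ.trans hβs).le hs θ)
      (re_rotate_circlePoint s θ)
    rcases le_total θ Real.pi with h | h
    · rw [← Real.cos_pi_div_two_sub]
      exact Real.cos_le_cos_of_nonneg_of_le_pi (by linarith) h hθ.1
    · rw [← Real.cos_pi_div_two_sub, ← Real.cos_two_pi_sub θ]
      exact Real.cos_le_cos_of_nonneg_of_le_pi (by linarith) (by linarith) (by linarith [hθ.2])

/-! ### Homotopy invariance of contour integrals -/

/-- The integrals of a holomorphic function along the four sides of a `C²` image of a rectangle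
add up to zero: the 1-form `F(g) dg` is closed, so this is the divergence theorem. -/
theorem integral_homotopy {E : Type*} [NormedAddCommGroup E] [NormedSpace ℂ E] [CompleteSpace E]
    {g : ℝ × ℝ → ℂ} (hg : ContDiff ℝ 2 g) {gs gt : ℝ → ℝ → ℂ}
    (hgs : ∀ s t, HasDerivAt (fun s => g (s, t)) (gs s t) s)
    (hgt : ∀ s t, HasDerivAt (fun t => g (s, t)) (gt s t) t)
    {F : ℂ → E} {U : Set ℂ} (hU : IsOpen U) (hF : DifferentiableOn ℂ F U) {a b c d : ℝ}
    (hmem : ∀ p ∈ Set.uIcc a b ×ˢ Set.uIcc c d, g p ∈ U) :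
    (∫ t in c..d, gt b t • F (g (b, t))) - (∫ t in c..d, gt a t • F (g (a, t))) =
      (∫ s in a..b, gs s d • F (g (s, d))) - ∫ s in a..b, gs s c • F (g (s, c)) := by
  have hdiff : ∀ p, HasFDerivAt g (fderiv ℝ g p) p := fun p =>
    (hg.differentiable (by decide) p).hasFDerivAt
  have hgs' : ∀ p : ℝ × ℝ, fderiv ℝ g p (1, 0) = gs p.1 p.2 := fun p =>
    ((hdiff p).comp_hasDerivAt p.1
      (HasDerivAt.prodMk (hasDerivAt_id p.1) (hasDerivAt_const p.1 p.2))).unique (hgs p.1 p.2)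
  have hgt' : ∀ p : ℝ × ℝ, fderiv ℝ g p (0, 1) = gt p.1 p.2 := fun p =>
    ((hdiff p).comp_hasDerivAt p.2
      (HasDerivAt.prodMk (hasDerivAt_const p.2 p.1) (hasDerivAt_id p.2))).unique (hgt p.1 p.2)
  have hdd : ∀ p, HasFDerivAt (fderiv ℝ g) (fderiv ℝ (fderiv ℝ g) p) p := fun p =>
    ((hg.fderiv_right (m := 1) (by norm_num)).differentiable (by decide) p).hasFDerivAt
  have hsymm : ∀ p v w, fderiv ℝ (fderiv ℝ g) p v w = fderiv ℝ (fderiv ℝ g) p w v := fun p v w =>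
    (hg.contDiffAt.isSymmSndFDerivAt (by simp)).eq v w
  have hFg : ∀ p, g p ∈ U → HasFDerivAt (fun p => F (g p))
      (((fderiv ℂ F (g p)).restrictScalars ℝ).comp (fderiv ℝ g p)) p := fun p hp =>
    ((((hF _ hp).differentiableAt (hU.mem_nhds hp)).hasFDerivAt).restrictScalars ℝ).comp p (hdiff p)
  have happ : ∀ v p, HasFDerivAt (fun p => fderiv ℝ g p v)
      ((ContinuousLinearMap.apply ℝ ℂ v).comp (fderiv ℝ (fderiv ℝ g) p)) p := fun v p =>
    (ContinuousLinearMap.apply ℝ ℂ v).hasFDerivAt.comp p (hdd p)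
  have hder : ∀ v p, g p ∈ U → HasFDerivAt (fun p => fderiv ℝ g p v • F (g p)) _ p := fun v p hp =>
    (happ v p).smul (hFg p hp)
  have hsub : ∀ {p}, p ∈ Set.Ioo (min a b) (max a b) ×ˢ Set.Ioo (min c d) (max c d) → g p ∈ U :=
    fun {p} hp => hmem p ⟨Set.Ioo_subset_Icc_self hp.1, Set.Ioo_subset_Icc_self hp.2⟩
  have hzero : ∀ p, (fderiv ℝ g p (0, 1) • (((fderiv ℂ F (g p)).restrictScalars ℝ).comp
        (fderiv ℝ g p)) + ((ContinuousLinearMap.apply ℝ ℂ (0, 1)).comp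
          (fderiv ℝ (fderiv ℝ g) p)).smulRight (F (g p))) (1, 0) +
      (-(fderiv ℝ g p (1, 0) • (((fderiv ℂ F (g p)).restrictScalars ℝ).comp
        (fderiv ℝ g p)) + ((ContinuousLinearMap.apply ℝ ℂ (1, 0)).comp
          (fderiv ℝ (fderiv ℝ g) p)).smulRight (F (g p)))) (0, 1) = 0 := by
    intro p
    have h1 : ∀ w : ℂ, fderiv ℂ F (g p) w = w • fderiv ℂ F (g p) 1 := fun w => by
      rw [← map_smul, smul_eq_mul, mul_one]
    simp only [add_apply, neg_apply, smul_apply, ContinuousLinearMap.comp_apply,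
      ContinuousLinearMap.coe_restrictScalars', ContinuousLinearMap.smulRight_apply,
      ContinuousLinearMap.apply_apply]
    rw [h1 (fderiv ℝ g p (1, 0)), h1 (fderiv ℝ g p (0, 1)), hsymm p (1, 0) (0, 1), smul_smul,
      smul_smul, mul_comm]
    abel
  have key := integral2_divergence_prod_of_hasFDerivAt
    (fun p => fderiv ℝ g p (0, 1) • F (g p)) (fun p => -(fderiv ℝ g p (1, 0) • F (g p)))
    (fun p => fderiv ℝ g p (0, 1) • (((fderiv ℂ F (g p)).restrictScalars ℝ).comp
        (fderiv ℝ g p)) + ((ContinuousLinearMap.apply ℝ ℂ (0, 1)).comp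
          (fderiv ℝ (fderiv ℝ g) p)).smulRight (F (g p)))
    (fun p => -(fderiv ℝ g p (1, 0) • (((fderiv ℂ F (g p)).restrictScalars ℝ).comp
        (fderiv ℝ g p)) + ((ContinuousLinearMap.apply ℝ ℂ (1, 0)).comp
          (fderiv ℝ (fderiv ℝ g) p)).smulRight (F (g p)))) a c b d
    (fun p hp => (hder _ p (hmem p hp)).continuousAt.continuousWithinAt)
    (fun p hp => (hder _ p (hmem p hp)).neg.continuousAt.continuousWithinAt)
    (fun p hp => hder _ p (hsub hp)) (fun p hp => (hder _ p (hsub hp)).neg)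
    (by simp only [hzero]; exact integrableOn_zero)
  simp only [hzero, intervalIntegral.integral_zero] at key
  simp only [hgs', hgt', intervalIntegral.integral_neg] at key
  rw [← sub_eq_zero]
  rw [key]
  abel

section

variable {E : Type*} [NormedAddCommGroup E] [NormedSpace ℂ E]

/-- A bound `‖(1 - z) F(z)‖ ≤ c |1 - z| ^ σ` becomes the integrable bound `t ^ (σ - 1)` in the
parameter of a segment that starts at `1`. -/
theorem norm_segment_integrand_le {F : ℂ → E} {P : ℂ} {c σ : ℝ}
    {t : ℝ} (ht : 0 < t)
    (hb : ‖(1 - (1 + t * (P - 1))) • F (1 + t * (P - 1))‖ ≤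
      c * ‖1 - (1 + t * (P - 1))‖ ^ σ) :
    ‖(P - 1) • F (1 + t * (P - 1))‖ ≤ c * ‖P - 1‖ ^ σ * t ^ (σ - 1) := by
  have h1 : (1 : ℂ) - (1 + t * (P - 1)) = -((t : ℂ) * (P - 1)) := by ring
  rw [h1, norm_smul, norm_neg, norm_mul, Complex.norm_real, Real.norm_of_nonneg ht.le,
    Real.mul_rpow ht.le (norm_nonneg _)] at hb
  rw [Real.rpow_sub_one ht.ne', norm_smul, ← mul_div_assoc, le_div_iff₀ ht]
  linarith

theorem intervalIntegrable_segment {F : ℂ → E} {P : ℂ} {c σ : ℝ} (hσ : 0 < σ)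
    (hc : ContinuousOn (fun t : ℝ => F (1 + t * (P - 1))) (Set.Ioc 0 1))
    (hb : ∀ t ∈ Set.Ioc (0 : ℝ) 1, ‖(1 - (1 + t * (P - 1))) • F (1 + t * (P - 1))‖ ≤
      c * ‖1 - (1 + t * (P - 1))‖ ^ σ) :
    IntervalIntegrable (fun t : ℝ => (P - 1) • F (1 + t * (P - 1))) volume 0 1 := by
  have hi : IntervalIntegrable (fun t : ℝ => c * ‖P - 1‖ ^ σ * t ^ (σ - 1)) volume 0 1 :=
    (intervalIntegral.intervalIntegrable_rpow' (by linarith)).const_mul _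
  rw [intervalIntegrable_iff_integrableOn_Ioc_of_le zero_le_one] at hi ⊢
  refine Integrable.mono' hi ((hc.const_smul (P - 1)).aestronglyMeasurable measurableSet_Ioc) ?_
  filter_upwards [ae_restrict_mem measurableSet_Ioc] with t ht
  exact norm_segment_integrand_le ht.1 (hb t ht)

/-- The integrals of `F` along the segments from `1` to `P a` and to `P b` differ by the integral
along the curve `P` of the endpoints; `F` may have an integrable singularity at `1`. -/
theorem segment_homotopy [CompleteSpace E] {P : ℝ → ℂ} (hP : ContDiff ℝ 2 P) {F : ℂ → E}
    {U : Set ℂ} (hU : IsOpen U) (hF : DifferentiableOn ℂ F U) {a b c σ : ℝ} (hσ : 0 < σ)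
    (hP1 : ∀ s ∈ Set.uIcc a b, P s ≠ 1)
    (hmem : ∀ s ∈ Set.uIcc a b, ∀ t ∈ Set.Ioc (0 : ℝ) 1, 1 + t * (P s - 1) ∈ U)
    (hb : ∀ s ∈ Set.uIcc a b, ∀ t ∈ Set.Ioc (0 : ℝ) 1,
      ‖(1 - (1 + t * (P s - 1))) • F (1 + t * (P s - 1))‖ ≤ c * ‖1 - (1 + t * (P s - 1))‖ ^ σ) :
    (∫ t in (0 : ℝ)..1, (P b - 1) • F (1 + t * (P b - 1))) -
      (∫ t in (0 : ℝ)..1, (P a - 1) • F (1 + t * (P a - 1))) =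
      ∫ s in a..b, deriv P s • F (P s) := by
  have hPd : Differentiable ℝ P := hP.differentiable (by decide)
  have hint : ∀ s ∈ Set.uIcc a b,
      IntervalIntegrable (fun t : ℝ => (P s - 1) • F (1 + t * (P s - 1))) volume 0 1 := by
    intro s hs
    refine intervalIntegrable_segment hσ ?_ (hb s hs)
    exact hF.continuousOn.comp (by fun_prop) (fun t ht => hmem s hs t ht)
  have heq : ∀ ε ∈ Set.Ioc (0 : ℝ) 1,
      (∫ t in ε..1, (P b - 1) • F (1 + t * (P b - 1))) -
      (∫ t in ε..1, (P a - 1) • F (1 + t * (P a - 1))) =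
      (∫ s in a..b, deriv P s • F (P s)) -
        ∫ s in a..b, (ε * deriv P s) • F (1 + ε * (P s - 1)) := by
    intro ε hε
    have := integral_homotopy (g := fun p : ℝ × ℝ => 1 + (p.2 : ℂ) * (P p.1 - 1))
      (gs := fun s t => t * deriv P s) (gt := fun s t => P s - 1)
      (by
        have h2 : ContDiff ℝ 2 (fun p : ℝ × ℝ => (p.2 : ℂ)) :=
          Complex.ofRealCLM.contDiff.comp contDiff_snd
        have h3 : ContDiff ℝ 2 (fun p : ℝ × ℝ => P p.1) := hP.comp contDiff_fst
        exact contDiff_const.add (h2.mul (h3.sub contDiff_const)))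
      (fun s t => (((hPd s).hasDerivAt.sub_const 1).const_mul (t : ℂ)).const_add 1)
      (fun s t => by
        have := ((Complex.ofRealCLM.hasDerivAt (x := t)).mul_const (P s - 1)).const_add 1
        simpa using this)
      hU hF (a := a) (b := b) (c := ε) (d := 1)
      (by
        rintro ⟨s, t⟩ ⟨hs, ht⟩
        rw [Set.uIcc_of_le hε.2] at ht
        exact hmem s hs t ⟨hε.1.trans_le ht.1, ht.2⟩)
    simpa using this
  -- the boundary term at the cut disappears as the cut approaches the vertex
  obtain ⟨M, hM⟩ : ∃ M, ∀ s ∈ Set.uIcc a b,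
      ‖‖deriv P s‖ / ‖P s - 1‖ * (c * ‖P s - 1‖ ^ σ)‖ ≤ M := by
    refine isCompact_uIcc.exists_bound_of_continuousOn ?_
    have h1 : Continuous (deriv P) := hP.continuous_deriv (by decide)
    have h2 : ∀ s ∈ Set.uIcc a b, ‖P s - 1‖ ≠ 0 := fun s hs =>
      norm_ne_zero_iff.2 (sub_ne_zero.2 (hP1 s hs))
    have h3 : Continuous fun s => ‖P s - 1‖ := (hPd.continuous.sub continuous_const).norm
    exact (h1.norm.continuousOn.div h3.continuousOn h2).mul
      (continuousOn_const.mul (h3.continuousOn.rpow_const fun s hs => Or.inl (h2 s hs)))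
  have hlim0 : Tendsto (fun ε : ℝ => ∫ s in a..b, (ε * deriv P s) • F (1 + ε * (P s - 1)))
      (𝓝[>] 0) (𝓝 0) := by
    have hz : Tendsto (fun ε : ℝ => M * ε ^ σ * |b - a|) (𝓝[>] 0) (𝓝 0) := by
      have : ContinuousAt (fun ε : ℝ => M * ε ^ σ * |b - a|) 0 :=
        (continuousAt_const.mul (Real.continuousAt_rpow_const 0 σ (Or.inr hσ.le))).mul
          continuousAt_const
      have h := this.tendsto
      simp only [Real.zero_rpow hσ.ne', mul_zero, zero_mul] at h
      exact h.mono_left nhdsWithin_le_nhds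
    refine squeeze_zero_norm' ?_ hz
    filter_upwards [Ioc_mem_nhdsGT (zero_lt_one' ℝ)] with ε hε
    refine intervalIntegral.norm_integral_le_of_norm_le_const fun s hs => ?_
    have hs' := Set.uIoc_subset_uIcc hs
    have h1 := norm_segment_integrand_le hε.1 (hb s hs' ε hε)
    have h2 : 0 < ‖P s - 1‖ := norm_pos_iff.2 (sub_ne_zero.2 (hP1 s hs'))
    have h4 := (le_abs_self _).trans (hM s hs')
    rw [norm_smul, norm_mul, Complex.norm_real, Real.norm_of_nonneg hε.1.le]
    rw [norm_smul, Real.rpow_sub_one hε.1.ne'] at h1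
    have hεσ : 0 ≤ ε ^ σ := Real.rpow_nonneg hε.1.le σ
    calc ε * ‖deriv P s‖ * ‖F (1 + ε * (P s - 1))‖
        = ε * (‖deriv P s‖ / ‖P s - 1‖) * (‖P s - 1‖ * ‖F (1 + ε * (P s - 1))‖) := by
          field_simp
      _ ≤ ε * (‖deriv P s‖ / ‖P s - 1‖) * (c * ‖P s - 1‖ ^ σ * (ε ^ σ / ε)) := by
          have := hε.1
          gcongr
      _ = (‖deriv P s‖ / ‖P s - 1‖ * (c * ‖P s - 1‖ ^ σ)) * ε ^ σ := by
          have := hε.1.ne'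
          field_simp
      _ ≤ M * ε ^ σ := by gcongr
  have hlim : ∀ s ∈ Set.uIcc a b,
      Tendsto (fun ε : ℝ => ∫ t in ε..1, (P s - 1) • F (1 + t * (P s - 1))) (𝓝[>] 0)
        (𝓝 (∫ t in (0 : ℝ)..1, (P s - 1) • F (1 + t * (P s - 1)))) := by
    intro s hs
    have h1 := intervalIntegral.continuousOn_primitive_interval_left
      (f := fun t : ℝ => (P s - 1) • F (1 + t * (P s - 1))) (μ := volume) (a := 0) (b := 1)
      (by
        have := hint s hs
        rw [intervalIntegrable_iff_integrableOn_Icc_of_le zero_le_one] at this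
        rwa [Set.uIcc_of_le zero_le_one])
    have h2 := h1 0 (by simp)
    rw [ContinuousWithinAt, Set.uIcc_of_le zero_le_one] at h2
    exact h2.mono_left (nhdsWithin_le_of_mem (Icc_mem_nhdsGT zero_lt_one))
  refine tendsto_nhds_unique ((hlim b Set.right_mem_uIcc).sub (hlim a Set.left_mem_uIcc)) ?_
  have h := (tendsto_const_nhds (x := ∫ s in a..b, deriv P s • F (P s))).sub hlim0
  rw [sub_zero] at h
  refine h.congr' ?_
  filter_upwards [Ioc_mem_nhdsGT (zero_lt_one' ℝ)] with ε hε
  exact (heq ε hε).symm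

end

/-! ### Integrals along the boundary of a Stolz domain -/

variable {X : Type*} [NormedAddCommGroup X] [NormedSpace ℂ X]

theorem segmentIntegral_symm (a b : ℂ) (F : ℂ → X →L[ℂ] X) :
    segmentIntegral b a F = -segmentIntegral a b F := by
  have h := intervalIntegral.integral_comp_sub_left
    (fun t : ℝ => (b - a) • F (a + t * (b - a))) (a := 0) (b := 1) 1
  simp only [sub_zero, sub_self] at h
  rw [segmentIntegral, segmentIntegral, ← h, ← intervalIntegral.integral_neg]
  refine intervalIntegral.integral_congr fun t _ => ?_
  simp only [← neg_smul, neg_sub]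
  congr 2
  push_cast
  ring

theorem contDiff_circlePoint {E : Type*} [NormedAddCommGroup E] [NormedSpace ℝ E]
    {u v : E → ℝ} (hu : ContDiff ℝ 2 u) (hv : ContDiff ℝ 2 v) :
    ContDiff ℝ 2 fun p => circlePoint (u p) (v p) := by
  unfold circlePoint
  have h1 : ContDiff ℝ 2 fun p => (Real.sin (u p) : ℂ) :=
    Complex.ofRealCLM.contDiff.comp (Real.contDiff_sin.comp hu)
  have h2 : ContDiff ℝ 2 fun p => (v p : ℂ) := Complex.ofRealCLM.contDiff.comp hv
  exact h1.mul (contDiff_const.mul h2).cexp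

/-- Both segments are parametrized from the vertex `1`. -/
theorem stolzBoundaryIntegral_eq_add_sub (s : ℝ) (F : ℂ → X →L[ℂ] X) :
    stolzBoundaryIntegral s F =
      (∫ t in (0 : ℝ)..1, (circlePoint s (Real.pi / 2 - s) - 1) •
        F (1 + t * (circlePoint s (Real.pi / 2 - s) - 1))) +
      (∫ θ in (Real.pi / 2 - s)..(3 * Real.pi / 2 + s),
        (Complex.I * circlePoint s θ) • F (circlePoint s θ)) -
      ∫ t in (0 : ℝ)..1, (circlePoint s (3 * Real.pi / 2 + s) - 1) •
        F (1 + t * (circlePoint s (3 * Real.pi / 2 + s) - 1)) := by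
  rw [stolzBoundaryIntegral, segmentIntegral_symm 1 (circlePoint s (3 * Real.pi / 2 + s)),
    ← sub_eq_add_neg]
  rfl

theorem stolzBoundaryIntegral_zero (F : ℂ → X →L[ℂ] X) : stolzBoundaryIntegral 0 F = 0 := by
  rw [stolzBoundaryIntegral_eq_add_sub]
  simp [circlePoint]

theorem hasDerivAt_circlePoint_comp {s m k t : ℝ} :
    HasDerivAt (fun t : ℝ => circlePoint s (m * t + k))
      (m * (Complex.I * circlePoint s (m * t + k))) t := by
  unfold circlePoint
  have h1 : HasDerivAt (fun t : ℝ => ((m * t + k : ℝ) : ℂ)) (m : ℂ) t := by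
    have := (((hasDerivAt_id t).const_mul m).add_const k).ofReal_comp
    simpa using this
  have h2 := ((h1.const_mul Complex.I).cexp).const_mul (Real.sin s : ℂ)
  exact h2.congr_deriv (by ring)

/-- The integrals of `F` along the arcs of `∂B_a` and `∂B_b` differ by the integrals along the two
curves of tangent points. These terms also occur for the segments, by `segment_homotopy`. -/
theorem arc_homotopy {E : Type*} [NormedAddCommGroup E] [NormedSpace ℂ E] [CompleteSpace E]
    {F : ℂ → E} {U : Set ℂ} (hU : IsOpen U)
    (hF : DifferentiableOn ℂ F U) {a b : ℝ} (ha : 0 ≤ a) (hab : a ≤ b)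
    (hmem : ∀ s ∈ Set.Icc a b, stolzContour s ⊆ U) :
    (∫ θ in (Real.pi / 2 - b)..(3 * Real.pi / 2 + b),
        (Complex.I * circlePoint b θ) • F (circlePoint b θ)) -
      (∫ θ in (Real.pi / 2 - a)..(3 * Real.pi / 2 + a),
        (Complex.I * circlePoint a θ) • F (circlePoint a θ)) =
    (∫ s in a..b, deriv (fun s => circlePoint s (3 * Real.pi / 2 + s)) s •
        F (circlePoint s (3 * Real.pi / 2 + s))) -
      ∫ s in a..b, deriv (fun s => circlePoint s (Real.pi / 2 - s)) s •
        F (circlePoint s (Real.pi / 2 - s)) := by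
  have hpi := Real.pi_pos
  have hg : ContDiff ℝ 2 fun p : ℝ × ℝ =>
      circlePoint p.1 ((2 * p.1 + Real.pi) * p.2 + (Real.pi / 2 - p.1)) :=
    contDiff_circlePoint (by fun_prop) (by fun_prop)
  have hsub : ∀ s : ℝ, (∫ θ in (Real.pi / 2 - s)..(3 * Real.pi / 2 + s),
        (Complex.I * circlePoint s θ) • F (circlePoint s θ)) =
      ∫ t in (0 : ℝ)..1, (((2 * s + Real.pi : ℝ) : ℂ) *
          (Complex.I * circlePoint s ((2 * s + Real.pi) * t + (Real.pi / 2 - s)))) •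
        F (circlePoint s ((2 * s + Real.pi) * t + (Real.pi / 2 - s))) := by
    intro s
    have h := intervalIntegral.smul_integral_comp_mul_add (a := 0) (b := 1)
      (fun θ : ℝ => (Complex.I * circlePoint s θ) • F (circlePoint s θ))
      (2 * s + Real.pi) (Real.pi / 2 - s)
    rw [show (2 * s + Real.pi) * 0 + (Real.pi / 2 - s) = Real.pi / 2 - s by ring,
      show (2 * s + Real.pi) * 1 + (Real.pi / 2 - s) = 3 * Real.pi / 2 + s by ring] at h
    rw [← h, ← intervalIntegral.integral_smul]
    refine intervalIntegral.integral_congr fun t _ => ?_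
    simp only [mul_smul, Complex.coe_smul]
  have key := integral_homotopy hg
    (gs := fun s t => deriv (fun s => circlePoint s
      ((2 * s + Real.pi) * t + (Real.pi / 2 - s))) s)
    (gt := fun s t => ((2 * s + Real.pi : ℝ) : ℂ) *
      (Complex.I * circlePoint s ((2 * s + Real.pi) * t + (Real.pi / 2 - s))))
    (fun s t => by
      refine DifferentiableAt.hasDerivAt ?_
      exact (ContDiff.differentiable (contDiff_circlePoint (u := fun s : ℝ => s)
        (v := fun s : ℝ => (2 * s + Real.pi) * t + (Real.pi / 2 - s)) (by fun_prop) (by fun_prop))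
        (by decide)) s)
    (fun s t => hasDerivAt_circlePoint_comp (m := 2 * s + Real.pi) (k := Real.pi / 2 - s))
    hU hF (a := a) (b := b) (c := 0) (d := 1)
    (by
      rintro ⟨s, t⟩ ⟨hs, ht⟩
      rw [Set.uIcc_of_le hab] at hs
      rw [Set.uIcc_of_le zero_le_one] at ht
      refine hmem s hs (Or.inr ⟨_, ⟨?_, ?_⟩, rfl⟩)
      · have : 0 ≤ (2 * s + Real.pi) * t :=
          mul_nonneg (by linarith [ha.trans hs.1]) ht.1
        simp only
        linarith
      · have : (2 * s + Real.pi) * t ≤ 2 * s + Real.pi :=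
          mul_le_of_le_one_right (by linarith [ha.trans hs.1]) ht.2
        simp only
        linarith)
  rw [hsub, hsub]
  have e1 : ∀ s : ℝ, (2 * s + Real.pi) * 1 + (Real.pi / 2 - s) = 3 * Real.pi / 2 + s :=
    fun s => by ring
  have e0 : ∀ s : ℝ, (2 * s + Real.pi) * 0 + (Real.pi / 2 - s) = Real.pi / 2 - s :=
    fun s => by ring
  simp only [e1, e0] at key
  exact key

/-- Cauchy's theorem for the boundaries of Stolz domains: a function that is holomorphic near all
of the contours `∂B_s`, `a ≤ s ≤ b`, apart from the common vertex `1`, where it may have an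
integrable singularity, has the same integral along `∂B_a` and `∂B_b`. -/
theorem stolzBoundaryIntegral_congr [CompleteSpace X] {F : ℂ → X →L[ℂ] X} {U : Set ℂ}
    (hU : IsOpen U) (hF : DifferentiableOn ℂ F U) {a b c σ : ℝ} (ha : 0 ≤ a) (hab : a ≤ b)
    (hb : b < Real.pi / 2) (hσ : 0 < σ) (hmem : ∀ s ∈ Set.Icc a b, stolzContour s ⊆ U)
    (hbd : ∀ s ∈ Set.Icc a b, ∀ z ∈ stolzContour s, ‖(1 - z) • F z‖ ≤ c * ‖1 - z‖ ^ σ) :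
    stolzBoundaryIntegral a F = stolzBoundaryIntegral b F := by
  have harc := arc_homotopy hU hF ha hab hmem
  have h1 := segment_homotopy (P := fun s => circlePoint s (Real.pi / 2 - s))
    (contDiff_circlePoint (by fun_prop) (by fun_prop)) hU hF (a := a) (b := b) (c := c) hσ
    (fun s hs => by
      rw [Set.uIcc_of_le hab] at hs
      exact circlePoint_ne_one (ha.trans hs.1) (hs.2.trans_lt hb) _)
    (fun s hs t ht => hmem s (by rwa [Set.uIcc_of_le hab] at hs) (Or.inl (Or.inl ⟨t, ht, rfl⟩)))
    (fun s hs t ht => hbd s (by rwa [Set.uIcc_of_le hab] at hs) _ (Or.inl (Or.inl ⟨t, ht, rfl⟩)))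
  have h2 := segment_homotopy (P := fun s => circlePoint s (3 * Real.pi / 2 + s))
    (contDiff_circlePoint (by fun_prop) (by fun_prop)) hU hF (a := a) (b := b) (c := c) hσ
    (fun s hs => by
      rw [Set.uIcc_of_le hab] at hs
      exact circlePoint_ne_one (ha.trans hs.1) (hs.2.trans_lt hb) _)
    (fun s hs t ht => hmem s (by rwa [Set.uIcc_of_le hab] at hs) (Or.inl (Or.inr ⟨t, ht, rfl⟩)))
    (fun s hs t ht => hbd s (by rwa [Set.uIcc_of_le hab] at hs) _ (Or.inl (Or.inr ⟨t, ht, rfl⟩)))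
  rw [stolzBoundaryIntegral_eq_add_sub, stolzBoundaryIntegral_eq_add_sub]
  rw [sub_eq_iff_eq_add] at harc h1 h2
  rw [harc, h1, h2]
  abel

/-- Continuity on the contour `∂B_s`, with at most an integrable power singularity at the
vertex `1`. -/
def AdmissibleOn (s : ℝ) (F : ℂ → X →L[ℂ] X) : Prop :=
  ContinuousOn F (stolzContour s) ∧ ∃ c σ : ℝ, 0 < σ ∧
    ∀ z ∈ stolzContour s, ‖(1 - z) • F z‖ ≤ c * ‖1 - z‖ ^ σ

theorem continuousOn_segment {E : Type*} [TopologicalSpace E] {s θ : ℝ} {F : ℂ → E}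
    (hθ : θ = Real.pi / 2 - s ∨ θ = 3 * Real.pi / 2 + s)
    (hF : ContinuousOn F (stolzContour s)) :
    ContinuousOn (fun t : ℝ => F (1 + t * (circlePoint s θ - 1))) (Set.Ioc 0 1) := by
  refine hF.comp (by fun_prop) fun t ht => ?_
  rcases hθ with rfl | rfl
  · exact Or.inl (Or.inl ⟨t, ht, rfl⟩)
  · exact Or.inl (Or.inr ⟨t, ht, rfl⟩)

theorem continuous_circlePoint (s : ℝ) : Continuous (circlePoint s) := by
  unfold circlePoint
  fun_prop

theorem continuousOn_arc {E : Type*} [TopologicalSpace E] {s : ℝ} {F : ℂ → E}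
    (hF : ContinuousOn F (stolzContour s)) :
    ContinuousOn (fun θ : ℝ => F (circlePoint s θ))
      (Set.Icc (Real.pi / 2 - s) (3 * Real.pi / 2 + s)) :=
  hF.comp (continuous_circlePoint s).continuousOn fun θ hθ => Or.inr ⟨θ, hθ, rfl⟩

namespace AdmissibleOn

variable {s : ℝ} {F G : ℂ → X →L[ℂ] X}

theorem segment (hF : AdmissibleOn s F) {θ : ℝ}
    (hθ : θ = Real.pi / 2 - s ∨ θ = 3 * Real.pi / 2 + s) :
    IntervalIntegrable (fun t : ℝ => (circlePoint s θ - 1) •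
      F (1 + t * (circlePoint s θ - 1))) volume 0 1 := by
  obtain ⟨hc, c, σ, hσ, hb⟩ := hF
  refine intervalIntegrable_segment hσ (continuousOn_segment hθ hc) fun t ht => hb _ ?_
  rcases hθ with rfl | rfl
  · exact Or.inl (Or.inl ⟨t, ht, rfl⟩)
  · exact Or.inl (Or.inr ⟨t, ht, rfl⟩)

theorem arc (hF : AdmissibleOn s F) (hs : 0 ≤ s) :
    IntervalIntegrable (fun θ : ℝ => (Complex.I * circlePoint s θ) • F (circlePoint s θ))
      volume (Real.pi / 2 - s) (3 * Real.pi / 2 + s) := by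
  refine ContinuousOn.intervalIntegrable ?_
  rw [Set.uIcc_of_le (by linarith [Real.pi_pos])]
  exact (continuousOn_const.mul (continuous_circlePoint s).continuousOn).smul
    (continuousOn_arc hF.1)

theorem integral_add (hF : AdmissibleOn s F) (hG : AdmissibleOn s G) (hs : 0 ≤ s) :
    stolzBoundaryIntegral s (fun z => F z + G z) =
      stolzBoundaryIntegral s F + stolzBoundaryIntegral s G := by
  simp only [stolzBoundaryIntegral_eq_add_sub, smul_add]
  rw [intervalIntegral.integral_add (hF.segment (Or.inl rfl)) (hG.segment (Or.inl rfl)),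
    intervalIntegral.integral_add (hF.segment (Or.inr rfl)) (hG.segment (Or.inr rfl)),
    intervalIntegral.integral_add (hF.arc hs) (hG.arc hs)]
  abel

theorem integral_clm [CompleteSpace X] (hF : AdmissibleOn s F) (hs : 0 ≤ s)
    (L : (X →L[ℂ] X) →L[ℂ] (X →L[ℂ] X)) :
    stolzBoundaryIntegral s (fun z => L (F z)) = L (stolzBoundaryIntegral s F) := by
  simp only [stolzBoundaryIntegral_eq_add_sub, map_add, map_sub]
  rw [← L.intervalIntegral_comp_comm (hF.segment (Or.inl rfl)),
    ← L.intervalIntegral_comp_comm (hF.segment (Or.inr rfl)),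
    ← L.intervalIntegral_comp_comm (hF.arc hs)]
  simp only [map_smul]

end AdmissibleOn

theorem stolzBoundaryIntegral_const_smul (s : ℝ) (w : ℂ) (F : ℂ → X →L[ℂ] X) :
    stolzBoundaryIntegral s (fun z => w • F z) = w • stolzBoundaryIntegral s F := by
  simp only [stolzBoundaryIntegral_eq_add_sub, smul_add, smul_sub,
    ← intervalIntegral.integral_smul, smul_comm w]

theorem stolzBoundaryIntegral_congr_contour {s : ℝ} (hs : 0 ≤ s) {F G : ℂ → X →L[ℂ] X}
    (h : Set.EqOn F G (stolzContour s)) :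
    stolzBoundaryIntegral s F = stolzBoundaryIntegral s G := by
  have hseg : ∀ θ, (θ = Real.pi / 2 - s ∨ θ = 3 * Real.pi / 2 + s) →
      (∫ t in (0 : ℝ)..1, (circlePoint s θ - 1) • F (1 + t * (circlePoint s θ - 1))) =
        ∫ t in (0 : ℝ)..1, (circlePoint s θ - 1) • G (1 + t * (circlePoint s θ - 1)) := by
    intro θ hθ
    refine intervalIntegral.integral_congr_ae (Eventually.of_forall fun t ht => ?_)
    rw [Set.uIoc_of_le zero_le_one] at ht
    refine congrArg _ (h ?_)
    rcases hθ with rfl | rfl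
    · exact Or.inl (Or.inl ⟨t, ht, rfl⟩)
    · exact Or.inl (Or.inr ⟨t, ht, rfl⟩)
  rw [stolzBoundaryIntegral_eq_add_sub, stolzBoundaryIntegral_eq_add_sub,
    hseg _ (Or.inl rfl), hseg _ (Or.inr rfl)]
  congr 2
  refine intervalIntegral.integral_congr fun θ hθ => ?_
  rw [Set.uIcc_of_le (by linarith [Real.pi_pos])] at hθ
  exact congrArg _ (h (Or.inr ⟨θ, hθ, rfl⟩))

/-- Dominated convergence on the contour. -/
theorem tendsto_stolzBoundaryIntegral {s c σ : ℝ} (hs : 0 ≤ s) (hs1 : s < Real.pi / 2)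
    (hσ : 0 < σ) {F : ℕ → ℂ → X →L[ℂ] X} {G : ℂ → X →L[ℂ] X}
    (hc : ∀ n, ContinuousOn (F n) (stolzContour s))
    (hb : ∀ n, ∀ z ∈ stolzContour s, ‖(1 - z) • F n z‖ ≤ c * ‖1 - z‖ ^ σ)
    (hlim : ∀ z ∈ stolzContour s, Tendsto (fun n => F n z) atTop (𝓝 (G z))) :
    Tendsto (fun n => stolzBoundaryIntegral s (F n)) atTop (𝓝 (stolzBoundaryIntegral s G)) := by
  have hseg : ∀ θ, (θ = Real.pi / 2 - s ∨ θ = 3 * Real.pi / 2 + s) →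
      Tendsto (fun n => ∫ t in (0 : ℝ)..1, (circlePoint s θ - 1) •
          F n (1 + t * (circlePoint s θ - 1))) atTop
        (𝓝 (∫ t in (0 : ℝ)..1, (circlePoint s θ - 1) • G (1 + t * (circlePoint s θ - 1)))) := by
    intro θ hθ
    have hmem : ∀ t ∈ Set.Ioc (0 : ℝ) 1, 1 + t * (circlePoint s θ - 1) ∈ stolzContour s := by
      intro t ht
      rcases hθ with rfl | rfl
      · exact Or.inl (Or.inl ⟨t, ht, rfl⟩)
      · exact Or.inl (Or.inr ⟨t, ht, rfl⟩)
    refine intervalIntegral.tendsto_integral_filter_of_dominated_convergence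
      (fun t : ℝ => c * ‖circlePoint s θ - 1‖ ^ σ * t ^ (σ - 1)) ?_ ?_ ?_ ?_
    · refine Eventually.of_forall fun n => ?_
      rw [Set.uIoc_of_le zero_le_one]
      exact ((continuousOn_segment hθ (hc n)).const_smul
        (circlePoint s θ - 1)).aestronglyMeasurable measurableSet_Ioc
    · refine Eventually.of_forall fun n => Eventually.of_forall fun t ht => ?_
      rw [Set.uIoc_of_le zero_le_one] at ht
      exact norm_segment_integrand_le (F := F n) (P := circlePoint s θ) ht.1
        (hb n _ (hmem t ht))
    · exact (intervalIntegral.intervalIntegrable_rpow' (by linarith)).const_mul _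
    · refine Eventually.of_forall fun t ht => ?_
      rw [Set.uIoc_of_le zero_le_one] at ht
      exact (hlim _ (hmem t ht)).const_smul _
  have harc : Tendsto (fun n => ∫ θ in (Real.pi / 2 - s)..(3 * Real.pi / 2 + s),
        (Complex.I * circlePoint s θ) • F n (circlePoint s θ)) atTop
      (𝓝 (∫ θ in (Real.pi / 2 - s)..(3 * Real.pi / 2 + s),
        (Complex.I * circlePoint s θ) • G (circlePoint s θ))) := by
    have hle : Real.pi / 2 - s ≤ 3 * Real.pi / 2 + s := by linarith [Real.pi_pos]
    have hne : ∀ θ, (0 : ℝ) < ‖1 - circlePoint s θ‖ := fun θ =>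
      norm_pos_iff.2 (sub_ne_zero.2 (circlePoint_ne_one hs hs1 θ).symm)
    have hcn : Continuous fun θ => ‖1 - circlePoint s θ‖ :=
      (continuous_const.sub (continuous_circlePoint s)).norm
    refine intervalIntegral.tendsto_integral_filter_of_dominated_convergence
      (fun θ : ℝ => ‖Complex.I * circlePoint s θ‖ *
        (c * ‖1 - circlePoint s θ‖ ^ σ / ‖1 - circlePoint s θ‖)) ?_ ?_ ?_ ?_
    · refine Eventually.of_forall fun n => ?_
      rw [Set.uIoc_of_le hle]
      exact (((continuousOn_const.mul (continuous_circlePoint s).continuousOn).smul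
        (continuousOn_arc (hc n))).mono Set.Ioc_subset_Icc_self).aestronglyMeasurable
          measurableSet_Ioc
    · refine Eventually.of_forall fun n => Eventually.of_forall fun θ hθ => ?_
      rw [Set.uIoc_of_le hle] at hθ
      rw [norm_smul]
      refine mul_le_mul_of_nonneg_left ?_ (norm_nonneg _)
      rw [le_div_iff₀ (hne θ), mul_comm, ← norm_smul]
      exact hb n _ (Or.inr ⟨θ, Set.Ioc_subset_Icc_self hθ, rfl⟩)
    · refine Continuous.intervalIntegrable ?_ _ _
      exact (continuous_const.mul (continuous_circlePoint s)).norm.mul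
        ((continuous_const.mul (hcn.rpow_const fun θ => Or.inl (hne θ).ne')).div hcn
          fun θ => (hne θ).ne')
    · refine Eventually.of_forall fun θ hθ => ?_
      rw [Set.uIoc_of_le hle] at hθ
      exact (hlim _ (Or.inr ⟨θ, Set.Ioc_subset_Icc_self hθ, rfl⟩)).const_smul _
  simp only [stolzBoundaryIntegral_eq_add_sub]
  exact ((hseg _ (Or.inl rfl)).add harc).sub (hseg _ (Or.inr rfl))

/-! ### Rademacher averages and R-boundedness -/

instance : IsProbabilityMeasure signMeasure := by
  unfold signMeasure
  infer_instance

theorem measurable_rademacher (k : ℕ) : Measurable (rademacher k) := by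
  unfold rademacher
  exact (measurable_of_finite (fun b : Bool => if b then (1 : ℝ) else -1)).comp
    (measurable_pi_apply k)

theorem rademacher_mul_self (k : ℕ) (u : SignSpace) : rademacher k u * rademacher k u = 1 := by
  unfold rademacher
  split_ifs <;> norm_num

theorem norm_rademacher (k : ℕ) (u : SignSpace) : ‖rademacher k u‖ = 1 := by
  unfold rademacher
  split_ifs <;> norm_num

/-- Changing the signs of the coordinates that are selected by `p`. -/
def flipSigns (p : ℕ → Bool) (u : SignSpace) : SignSpace := fun k => xor (p k) (u k)

theorem measurePreserving_flipSigns (p : ℕ → Bool) :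
    MeasurePreserving (flipSigns p) signMeasure signMeasure := by
  have hmap : ∀ b : Bool, (PMF.uniformOfFintype Bool).toMeasure.map (xor b) =
      (PMF.uniformOfFintype Bool).toMeasure := by
    intro b
    refine Measure.ext_of_singleton fun c => ?_
    rw [Measure.map_apply (measurable_of_finite _) (measurableSet_singleton c)]
    have : xor b ⁻¹' {c} = {xor b c} := by
      ext d
      cases b <;> cases c <;> cases d <;> simp
    rw [this, PMF.toMeasure_apply_singleton _ _ (measurableSet_singleton _),
      PMF.toMeasure_apply_singleton _ _ (measurableSet_singleton _)]
    simp
  refine ⟨?_, ?_⟩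
  · exact measurable_pi_lambda _ fun k =>
      (measurable_of_finite (xor (p k))).comp (measurable_pi_apply k)
  · have h := Measure.infinitePi_map_pi (fun _ : ℕ => (PMF.uniformOfFintype Bool).toMeasure)
      (f := fun k => xor (p k)) (fun k => measurable_of_finite _)
    simp only [hmap] at h
    exact h

theorem rademacher_flipSigns (p : ℕ → Bool) (k : ℕ) (u : SignSpace) :
    rademacher k (flipSigns p u) = (if p k then -1 else 1) * rademacher k u := by
  unfold rademacher flipSigns
  cases p k <;> cases u k <;> simp

theorem integral_rademacher_mul (j k : ℕ) :
    ∫ u, rademacher j u * rademacher k u ∂signMeasure = if j = k then 1 else 0 := by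
  split_ifs with h
  · subst h
    simp [rademacher_mul_self]
  · have h1 := (measurePreserving_flipSigns (fun i => decide (i = j))).integral_comp'
      (f := ⟨⟨flipSigns (fun i => decide (i = j)), flipSigns (fun i => decide (i = j)),
        fun u => by funext k; simp [flipSigns],
        fun u => by funext k; simp [flipSigns]⟩,
        (measurePreserving_flipSigns _).measurable, (measurePreserving_flipSigns _).measurable⟩)
      (fun u => rademacher j u * rademacher k u)
    have h2 : ∀ u, rademacher j (flipSigns (fun i => decide (i = j)) u) *
        rademacher k (flipSigns (fun i => decide (i = j)) u) =
        -(rademacher j u * rademacher k u) := by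
      intro u
      have hk : k ≠ j := fun hkj => h hkj.symm
      rw [rademacher_flipSigns, rademacher_flipSigns]
      simp [hk]
    have h3 : ∫ u, rademacher j (flipSigns (fun i => decide (i = j)) u) *
        rademacher k (flipSigns (fun i => decide (i = j)) u) ∂signMeasure =
        ∫ u, rademacher j u * rademacher k u ∂signMeasure := h1
    simp only [h2, integral_neg] at h3
    linarith

theorem stronglyMeasurable_radSum (x : ℕ → X) (n : ℕ) : StronglyMeasurable (radSum x n) := by
  refine Finset.stronglyMeasurable_fun_sum _ fun k _ => ?_
  exact (measurable_rademacher k).stronglyMeasurable.smul_const (x k)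

theorem radNorm_add_le (x y : ℕ → X) (n : ℕ) :
    radNorm (fun k => x k + y k) n ≤ radNorm x n + radNorm y n := by
  have : radSum (fun k => x k + y k) n = radSum x n + radSum y n := by
    ext u
    simp [radSum, Finset.sum_add_distrib]
  unfold radNorm
  rw [this]
  exact eLpNorm_add_le (stronglyMeasurable_radSum x n).aestronglyMeasurable
    (stronglyMeasurable_radSum y n).aestronglyMeasurable (by norm_num)

theorem radNorm_const_smul (c : ℂ) (x : ℕ → X) (n : ℕ) :
    radNorm (fun k => c • x k) n = ‖c‖ₑ * radNorm x n := by
  have : radSum (fun k => c • x k) n = c • radSum x n := by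
    ext u
    simp only [radSum, Pi.smul_apply, Finset.smul_sum]
    exact Finset.sum_congr rfl fun k _ => smul_comm _ _ _
  unfold radNorm
  rw [this, eLpNorm_const_smul]

theorem radNorm_congr {x y : ℕ → X} {n : ℕ} (h : ∀ k < n, x k = y k) :
    radNorm x n = radNorm y n := by
  unfold radNorm
  congr 1
  ext u
  exact Finset.sum_congr rfl fun k hk => by rw [h k (Finset.mem_range.1 hk)]

/-- The Rademacher variables are jointly symmetric. -/
theorem radNorm_flip (p : ℕ → Bool) (x : ℕ → X) (n : ℕ) :
    radNorm (fun k => (if p k then (-1 : ℝ) else 1) • x k) n = radNorm x n := by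
  have : radSum (fun k => (if p k then (-1 : ℝ) else 1) • x k) n = radSum x n ∘ flipSigns p := by
    ext u
    refine Finset.sum_congr rfl fun k _ => ?_
    rw [rademacher_flipSigns, smul_smul, mul_comm]
  unfold radNorm
  rw [this, eLpNorm_comp_measurePreserving (stronglyMeasurable_radSum x n).aestronglyMeasurable
    (measurePreserving_flipSigns p)]

/-- `E` is `R`-bounded with constant `C`. -/
def RBoundedBy (C : ℝ≥0) (E : Set (X →L[ℂ] X)) : Prop :=
  ∀ (n : ℕ) (S : ℕ → X →L[ℂ] X) (x : ℕ → X), (∀ k < n, S k ∈ E) →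
    radNorm (fun k => S k (x k)) n ≤ C * radNorm x n

/-- `R`-bounds pass to closed convex hulls: for fixed vectors, the tuples of operators that satisfy
the inequality form a closed convex set. -/
theorem RBoundedBy.closure_convexHull {C : ℝ≥0} {E : Set (X →L[ℂ] X)} (hE : RBoundedBy C E) :
    RBoundedBy C (closure (convexHull ℝ E)) := by
  intro n S x hS
  set N : (Fin n → X →L[ℂ] X) → SignSpace → X :=
    fun V u => ∑ i : Fin n, rademacher i u • V i (x i) with hN
  have hNm : ∀ V, AEStronglyMeasurable (N V) signMeasure := fun V =>
    (Finset.stronglyMeasurable_fun_sum _ fun (i : Fin n) _ =>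
      (measurable_rademacher i).stronglyMeasurable.smul_const
        (V i (x i))).aestronglyMeasurable
  set A : Set (Fin n → X →L[ℂ] X) :=
    {V | eLpNorm (N V) 2 signMeasure ≤ C * radNorm x n} with hA
  have hrad : ∀ W : ℕ → X →L[ℂ] X,
      radNorm (fun k => W k (x k)) n = eLpNorm (N fun i => W i) 2 signMeasure := by
    intro W
    unfold radNorm
    congr 1
    ext u
    rw [radSum, Finset.sum_range]
  have hclosed : IsClosed A := by
    refine isClosed_of_closure_subset fun V hV => ?_
    obtain ⟨W, hW, hlim⟩ := mem_closure_iff_seq_limit.1 hV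
    refine (Lp.eLpNorm_lim_le_liminf_eLpNorm (fun j => hNm (W j)) (N V)
      (Eventually.of_forall fun u => ?_)).trans
      (liminf_le_of_frequently_le' (Frequently.of_forall hW))
    refine tendsto_finsetSum _ fun i _ => Tendsto.const_smul ?_ _
    exact ((ContinuousLinearMap.apply ℂ X (x i)).continuous.tendsto _).comp
      ((continuous_apply i).tendsto _ |>.comp hlim)
  have hconv : Convex ℝ A := by
    intro V hV W hW a b ha hb hab
    have : N (a • V + b • W) = a • N V + b • N W := by
      ext u
      simp only [hN, Pi.add_apply, Pi.smul_apply, add_apply, smul_apply, smul_add,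
        Finset.sum_add_distrib, Finset.smul_sum]
      congr 1 <;> exact Finset.sum_congr rfl fun i _ => smul_comm _ _ _
    rw [hA, Set.mem_ofPred_eq, this]
    refine (eLpNorm_add_le ((hNm V).const_smul a) ((hNm W).const_smul b) (by norm_num)).trans ?_
    rw [eLpNorm_const_smul, eLpNorm_const_smul, Real.enorm_eq_ofReal ha, Real.enorm_eq_ofReal hb]
    calc _ ≤ ENNReal.ofReal a * (C * radNorm x n) + ENNReal.ofReal b * (C * radNorm x n) :=
          add_le_add (mul_le_mul_right hV _) (mul_le_mul_right hW _)
      _ = C * radNorm x n := by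
          rw [← add_mul, ← ENNReal.ofReal_add ha hb, hab, ENNReal.ofReal_one, one_mul]
  have hsub : Set.pi Set.univ (fun _ : Fin n => E) ⊆ A := by
    intro V hV
    have h := hE n (fun k => if h : k < n then V ⟨k, h⟩ else 0) x
      (fun k hk => by simpa [hk] using hV ⟨k, hk⟩ (Set.mem_univ _))
    rw [hrad] at h
    have h' : eLpNorm (N V) 2 signMeasure ≤ C * radNorm x n := by simpa using h
    exact h'
  have h := closure_minimal (convexHull_min hsub hconv) hclosed
  rw [convexHull_pi, closure_pi_set] at h
  rw [hrad]
  exact h fun i _ => hS i i.2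

/-- The contraction principle for real coefficients. -/
theorem radNorm_contraction {a : ℕ → ℝ} {n : ℕ} (ha : ∀ k < n, |a k| ≤ 1) (x : ℕ → X) :
    radNorm (fun k => a k • x k) n ≤ radNorm x n := by
  have h1 : RBoundedBy 1 ({1, -1} : Set (X →L[ℂ] X)) := by
    intro n S x hS
    classical
    rw [ENNReal.coe_one, one_mul, ← radNorm_flip (fun k => decide (S k ≠ 1)) x n]
    refine (radNorm_congr fun k hk => ?_).le
    by_cases h : S k = 1
    · simp [h]
    · rcases hS k hk with h' | h'
      · exact absurd h' h
      · rw [Set.mem_singleton_iff] at h'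
        simp only [if_pos (decide_eq_true h)]
        rw [h']
        simp
  have h2 := h1.closure_convexHull n (fun k => a k • (1 : X →L[ℂ] X)) x (fun k hk => ?_)
  · simpa using h2
  · refine subset_closure ?_
    rw [convexHull_pair, segment_eq_image]
    refine ⟨(1 - a k) / 2, ⟨?_, ?_⟩, ?_⟩
    · linarith [(abs_le.1 (ha k hk)).2]
    · linarith [(abs_le.1 (ha k hk)).1]
    · simp only [smul_neg, ← sub_eq_add_neg, ← sub_smul]
      congr 1
      ring

/-- The multiples of the elements of `E` by complex numbers of modulus at most `1`. -/
def diskHull (E : Set (X →L[ℂ] X)) : Set (X →L[ℂ] X) :=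
  {V | ∃ c : ℂ, ‖c‖ ≤ 1 ∧ ∃ S ∈ E, V = c • S}

theorem RBoundedBy.diskHull {C : ℝ≥0} {E : Set (X →L[ℂ] X)} (hE : RBoundedBy C E) :
    RBoundedBy (2 * C) (diskHull E) := by
  intro n V x hV
  have hV' : ∀ k, ∃ c : ℂ, ∃ S : X →L[ℂ] X, k < n → ‖c‖ ≤ 1 ∧ S ∈ E ∧ V k = c • S := by
    intro k
    by_cases hk : k < n
    · obtain ⟨c, hc, S, hS, h⟩ := hV k hk
      exact ⟨c, S, fun _ => ⟨hc, hS, h⟩⟩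
    · exact ⟨0, 0, fun h => absurd h hk⟩
  choose c S h using hV'
  have hS := hE n S x fun k hk => (h k hk).2.1
  have h1 : radNorm (fun k => V k (x k)) n =
      radNorm (fun k => (c k).re • S k (x k) + Complex.I • ((c k).im • S k (x k))) n := by
    refine radNorm_congr fun k hk => ?_
    rw [(h k hk).2.2, smul_apply]
    conv_lhs => rw [← Complex.re_add_im (c k), add_smul, mul_comm, mul_smul]
    rfl
  rw [h1]
  refine (radNorm_add_le _ _ n).trans ?_
  rw [radNorm_const_smul]
  have hre := radNorm_contraction (n := n) (a := fun k => (c k).re)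
    (fun k hk => (Complex.abs_re_le_norm _).trans (h k hk).1) (fun k => S k (x k))
  have him := radNorm_contraction (n := n) (a := fun k => (c k).im)
    (fun k hk => (Complex.abs_im_le_norm _).trans (h k hk).1) (fun k => S k (x k))
  have hI : ‖Complex.I‖ₑ = 1 := by simp [enorm_eq_nnnorm]
  rw [hI, one_mul]
  calc _ ≤ C * radNorm x n + C * radNorm x n := add_le_add (hre.trans hS) (him.trans hS)
    _ = _ := by push_cast; ring

/-- Partial sums of a Rademacher series are dominated by its sum. -/
theorem radNorm_le_radSeriesNorm (x : ℕ → X) (n : ℕ) : radNorm x n ≤ radSeriesNorm x := by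
  refine le_iInf₂ fun f hf => ?_
  have h1 : ∀ m ≥ n, radNorm x n ≤ eLpNorm (radSum x m - f) 2 signMeasure +
      eLpNorm f 2 signMeasure := by
    intro m hm
    have h2 := radNorm_contraction (n := m) (a := fun k => if k < n then 1 else 0)
      (fun k _ => by split_ifs <;> simp) x
    have h3 : radNorm (fun k => (if k < n then (1 : ℝ) else 0) • x k) m = radNorm x n := by
      unfold radNorm
      congr 1
      ext u
      simp only [radSum, ite_smul, one_smul, zero_smul, smul_ite, smul_zero]
      rw [← Finset.sum_filter]
      congr 1
      ext k
      simp only [Finset.mem_filter, Finset.mem_range]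
      omega
    rw [h3] at h2
    refine h2.trans ?_
    have h4 : radSum x m = (radSum x m - f) + f := by simp
    calc radNorm x m = eLpNorm ((radSum x m - f) + f) 2 signMeasure := by rw [← h4]; rfl
      _ ≤ _ := eLpNorm_add_le ((stronglyMeasurable_radSum x m).aestronglyMeasurable.sub
          hf.1.aestronglyMeasurable) hf.1.aestronglyMeasurable (by norm_num)
  have h5 : Tendsto (fun m => eLpNorm (radSum x m - f) 2 signMeasure +
      eLpNorm f 2 signMeasure) atTop (𝓝 (0 + eLpNorm f 2 signMeasure)) :=
    hf.2.add tendsto_const_nhds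
  rw [zero_add] at h5
  exact ge_of_tendsto h5 (eventually_atTop.2 ⟨n, h1⟩)

/-- Trace duality: the pairing of two finite families is controlled by their Rademacher norms. -/
theorem enorm_sum_apply_le (x : ℕ → X) (y : ℕ → StrongDual ℂ X) (n : ℕ) :
    ‖∑ k ∈ Finset.range n, y k (x k)‖ₑ ≤ radNorm y n * radNorm x n := by
  have hint : ∀ j k, Integrable (fun u => (rademacher j u * rademacher k u) • y j (x k))
      signMeasure := fun j k => by
    refine Integrable.of_bound (C := ‖y j (x k)‖) ?_ (Eventually.of_forall fun u => ?_)
    · exact (((measurable_rademacher j).mul (measurable_rademacher k)).stronglyMeasurable.smul_const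
        _).aestronglyMeasurable
    · rw [norm_smul, norm_mul, norm_rademacher, norm_rademacher, one_mul, one_mul]
  have h1 : ∀ u, radSum y n u (radSum x n u) = ∑ j ∈ Finset.range n, ∑ k ∈ Finset.range n,
      (rademacher j u * rademacher k u) • y j (x k) := by
    intro u
    simp only [radSum, sum_apply, map_sum]
    rw [Finset.sum_comm]
    refine Finset.sum_congr rfl fun j _ => Finset.sum_congr rfl fun k _ => ?_
    rw [smul_apply, mul_smul, map_real_smul (y j)
      (y j).continuous]
  have h2 : ∑ k ∈ Finset.range n, y k (x k) =
      ∫ u, radSum y n u (radSum x n u) ∂signMeasure := by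
    simp only [h1]
    rw [integral_finsetSum _ fun j _ => integrable_finsetSum _ fun k _ => hint j k]
    refine Finset.sum_congr rfl fun j hj => ?_
    rw [integral_finsetSum _ fun k _ => hint j k]
    simp only [integral_smul_const, integral_rademacher_mul, ite_smul, one_smul, zero_smul]
    rw [Finset.sum_ite_eq, if_pos hj]
  rw [h2]
  refine (enorm_integral_le_lintegral_enorm _).trans ?_
  rw [← eLpNorm_one_eq_lintegral_enorm]
  have h3 := eLpNorm_le_eLpNorm_mul_eLpNorm'_of_norm (p := 2) (q := 2) (r := 1)
    (stronglyMeasurable_radSum y n).aestronglyMeasurable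
    (stronglyMeasurable_radSum x n).aestronglyMeasurable (μ := signMeasure)
    (fun (φ : StrongDual ℂ X) (v : X) => φ v) 1
    (Eventually.of_forall fun u => by
      simpa using (radSum y n u).le_opNorm (radSum x n u))
  rwa [ENNReal.coe_one, one_mul] at h3

/-! ### Contour integrals in absolutely convex hulls -/

/-- An integral of multiples `a t • V t` with `V t` in a closed convex set `K ∋ 0` lies in `A • K`
if `∫ a ≤ A`: otherwise a functional would separate it from `A • K`. -/
theorem inv_smul_integral_mem {E : Type*} [NormedAddCommGroup E] [NormedSpace ℝ E]
    [CompleteSpace E] {K : Set E} (hK : IsClosed K) (hconv : Convex ℝ K) (h0 : (0 : E) ∈ K)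
    {l r A : ℝ} (hlr : l ≤ r) (hA : 0 < A) {g : ℝ → E} {a : ℝ → ℝ}
    (hg : IntervalIntegrable g volume l r) (ha : IntervalIntegrable a volume l r)
    (hpos : ∀ t ∈ Set.Icc l r, 0 ≤ a t) (hint : ∫ t in l..r, a t ≤ A)
    (hmem : ∀ t ∈ Set.Ioc l r, ∃ V ∈ K, g t = a t • V) :
    A⁻¹ • ∫ t in l..r, g t ∈ K := by
  by_contra hnot
  obtain ⟨f, u, hf, hu⟩ := geometric_hahn_banach_closed_point hconv hK hnot
  have hu0 : 0 < u := by simpa using hf 0 h0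
  have h1 : f (∫ t in l..r, g t) ≤ A * u := by
    rw [← f.intervalIntegral_comp_comm hg]
    calc ∫ t in l..r, f (g t) ≤ ∫ t in l..r, a t * u := by
          refine intervalIntegral.integral_mono_on_of_le_Ioo hlr
            ⟨f.integrable_comp hg.1, f.integrable_comp hg.2⟩ (ha.mul_const u) fun t ht => ?_
          obtain ⟨V, hV, h⟩ := hmem t (Set.Ioo_subset_Ioc_self ht)
          rw [h, map_smul, smul_eq_mul]
          exact mul_le_mul_of_nonneg_left (hf V hV).le (hpos t (Set.Ioo_subset_Icc_self ht))
      _ = (∫ t in l..r, a t) * u := intervalIntegral.integral_mul_const _ _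
      _ ≤ A * u := mul_le_mul_of_nonneg_right hint hu0.le
  rw [map_smul, smul_eq_mul, lt_inv_mul_iff₀ hA] at hu
  linarith

/-- The number `q ^ k` is at most the mean of `1, q, …, q ^ k`. -/
theorem succ_mul_pow_mul_le {q : ℝ} (h0 : 0 ≤ q) (h1 : q ≤ 1) (k : ℕ) :
    ((k : ℝ) + 1) * q ^ k * (1 - q) ≤ 1 - q ^ (k + 1) := by
  induction k with
  | zero => simp
  | succ k ih =>
    have h2 : q ^ (k + 1) ≤ 1 := pow_le_one₀ h0 h1
    have h3 := mul_le_mul_of_nonneg_left ih h0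
    have h4 := mul_le_mul_of_nonneg_right h2 (sub_nonneg.2 h1)
    push_cast
    have e1 : q ^ (k + 1 + 1) = q * q ^ (k + 1) := pow_succ' q (k + 1)
    have e2 : q ^ (k + 1) = q * q ^ k := pow_succ' q k
    rw [e1]
    have e3 : ((k : ℝ) + 1 + 1) * q ^ (k + 1) * (1 - q) =
        q * (((k : ℝ) + 1) * q ^ k * (1 - q)) + q ^ (k + 1) * (1 - q) := by
      rw [e2]; ring
    rw [e3]
    nlinarith

theorem integral_succ_mul_pow_le {δ : ℝ} (h0 : 0 < δ) (h1 : δ ≤ 1) (k : ℕ) :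
    ∫ t in (0 : ℝ)..1, ((k : ℝ) + 1) * (1 - δ * t) ^ k ≤ 1 / δ := by
  have hd : ∀ t ∈ Set.uIcc (0 : ℝ) 1,
      HasDerivAt (fun t : ℝ => -(1 - δ * t) ^ (k + 1) / δ) (((k : ℝ) + 1) * (1 - δ * t) ^ k) t := by
    intro t _
    have h2 : HasDerivAt (fun t : ℝ => 1 - δ * t) (-δ) t := by
      have := ((hasDerivAt_id t).const_mul δ).const_sub 1
      simpa using this
    refine ((h2.pow (k + 1)).neg.div_const δ).congr_deriv ?_
    push_cast
    field_simp
  rw [intervalIntegral.integral_eq_sub_of_hasDerivAt hd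
    (Continuous.intervalIntegrable (by fun_prop) _ _)]
  simp only [mul_one, mul_zero, sub_zero, one_pow]
  rw [← sub_div, div_le_div_iff_of_pos_right h0]
  have := pow_nonneg (sub_nonneg.2 h1) (k + 1)
  linarith

section contour

variable {s : ℝ}

theorem sin_lt_one_of_lt (hs0 : 0 ≤ s) (hs : s < Real.pi / 2) : Real.sin s < 1 := by
  rw [← Real.sin_pi_div_two]
  exact Real.sin_lt_sin_of_lt_of_le_pi_div_two (by linarith [Real.pi_pos]) le_rfl hs

theorem norm_circlePoint_sub_one_le (hs0 : 0 ≤ s) (hs : s < Real.pi / 2) (θ : ℝ) :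
    ‖circlePoint s θ - 1‖ ≤ 2 := by
  refine (norm_sub_le _ _).trans ?_
  rw [norm_circlePoint hs0 (by linarith [Real.pi_pos]), norm_one]
  linarith [Real.sin_le_one s]

theorem norm_segment_le (hs0 : 0 ≤ s) (hs : s < Real.pi / 2) (θ : ℝ) {t : ℝ}
    (ht : t ∈ Set.Ioc (0 : ℝ) 1) :
    ‖1 + t * (circlePoint s θ - 1)‖ ≤ 1 - (1 - Real.sin s) * t := by
  have h : 1 + t * (circlePoint s θ - 1) = ((1 - t : ℝ) : ℂ) + t * circlePoint s θ := by
    push_cast; ring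
  rw [h]
  refine (norm_add_le _ _).trans ?_
  rw [norm_mul, Complex.norm_real, Complex.norm_real, Real.norm_of_nonneg ht.1.le,
    Real.norm_of_nonneg (sub_nonneg.2 ht.2), norm_circlePoint hs0 (by linarith [Real.pi_pos])]
  linarith

/-- On the contour, the distance to `1` is comparable to the distance to the unit circle. -/
theorem norm_one_sub_le_of_mem_stolzContour (hs0 : 0 ≤ s) (hs : s < Real.pi / 2) {z : ℂ}
    (hz : z ∈ stolzContour s) : ‖1 - z‖ * (1 - Real.sin s) ≤ 2 * (1 - ‖z‖) := by
  have hδ := sub_pos.2 (sin_lt_one_of_lt hs0 hs)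
  have hseg : ∀ θ : ℝ, ∀ t ∈ Set.Ioc (0 : ℝ) 1,
      ‖1 - (1 + t * (circlePoint s θ - 1))‖ * (1 - Real.sin s) ≤
        2 * (1 - ‖1 + t * (circlePoint s θ - 1)‖) := by
    intro θ t ht
    have h1 := norm_segment_le hs0 hs θ ht
    have h2 : ‖1 - (1 + t * (circlePoint s θ - 1))‖ ≤ t * 2 := by
      rw [show (1 : ℂ) - (1 + t * (circlePoint s θ - 1)) = -(t * (circlePoint s θ - 1)) by ring,
        norm_neg, norm_mul, Complex.norm_real, Real.norm_of_nonneg ht.1.le]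
      exact mul_le_mul_of_nonneg_left (norm_circlePoint_sub_one_le hs0 hs θ) ht.1.le
    nlinarith [mul_le_mul_of_nonneg_right h2 hδ.le]
  rcases hz with (⟨t, ht, rfl⟩ | ⟨t, ht, rfl⟩) | ⟨θ, -, rfl⟩
  · exact hseg _ t ht
  · exact hseg _ t ht
  · rw [norm_circlePoint hs0 (by linarith [Real.pi_pos]), norm_sub_rev]
    exact mul_le_mul_of_nonneg_right (norm_circlePoint_sub_one_le hs0 hs θ) hδ.le

theorem ne_one_of_mem_stolzContour (hs0 : 0 ≤ s) (hs : s < Real.pi / 2) {z : ℂ}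
    (hz : z ∈ stolzContour s) : z ≠ 1 := by
  have hseg : ∀ θ : ℝ, ∀ t ∈ Set.Ioc (0 : ℝ) 1, 1 + t * (circlePoint s θ - 1) ≠ 1 := by
    intro θ t ht h
    have h1 := norm_segment_le hs0 hs θ ht
    rw [h, norm_one] at h1
    nlinarith [mul_pos (sub_pos.2 (sin_lt_one_of_lt hs0 hs)) ht.1]
  rcases hz with (⟨t, ht, rfl⟩ | ⟨t, ht, rfl⟩) | ⟨θ, -, rfl⟩
  · exact hseg _ t ht
  · exact hseg _ t ht
  · exact circlePoint_ne_one hs0 hs θ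

theorem norm_lt_one_of_mem_stolzContour (hs0 : 0 ≤ s) (hs : s < Real.pi / 2) {z : ℂ}
    (hz : z ∈ stolzContour s) : ‖z‖ < 1 := by
  have h1 := norm_one_sub_le_of_mem_stolzContour hs0 hs hz
  have h2 : 0 < ‖1 - z‖ :=
    norm_pos_iff.2 (sub_ne_zero.2 (ne_one_of_mem_stolzContour hs0 hs hz).symm)
  nlinarith [mul_pos h2 (sub_pos.2 (sin_lt_one_of_lt hs0 hs))]

end contour

theorem zero_mem_diskHull {E : Set (X →L[ℂ] X)} (hE : E.Nonempty) : 0 ∈ diskHull E := by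
  obtain ⟨S, hS⟩ := hE
  exact ⟨0, by simp, S, hS, by simp⟩

theorem exists_mem_diskHull_smul {E : Set (X →L[ℂ] X)} {S : X →L[ℂ] X} (hS : S ∈ E) {w : ℂ}
    {a : ℝ} (ha : ‖w‖ ≤ a) : ∃ V ∈ diskHull E, w • S = a • V := by
  refine ⟨(w / a) • S, ⟨w / a, ?_, S, hS, rfl⟩, ?_⟩
  · rw [norm_div, Complex.norm_real, Real.norm_of_nonneg ((norm_nonneg w).trans ha)]
    exact div_le_one_of_le₀ ha ((norm_nonneg w).trans ha)
  · rcases eq_or_ne a 0 with h | h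
    · subst h
      have : w = 0 := by simpa using ha
      simp [this]
    · rw [← Complex.coe_smul, smul_smul, mul_div_cancel₀]
      exact_mod_cast h

/-- Contour integrals of `c(z) (z - 1) R(z)` with `|c(z)| ≤ B (k + 1) |z|^k` are combinations, with
coefficients that do not depend on `k`, of three elements of the closed absolutely convex hull of
the operators `(z - 1) R(z)`: the mass of `(k + 1) |z|^k |dz|` on the contour is bounded. -/
theorem exists_stolzBoundaryIntegral_eq [CompleteSpace X] {s B : ℝ} (hs0 : 0 < s)
    (hs : s < Real.pi / 2) (hB : 0 < B) {k : ℕ} {E : Set (X →L[ℂ] X)} {c : ℂ → ℂ}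
    {S : ℂ → X →L[ℂ] X} (hS : ∀ z ∈ stolzContour s, S z ∈ E)
    (hc : ∀ z ∈ stolzContour s, ‖c z‖ ≤ B * (((k : ℝ) + 1) * ‖z‖ ^ k))
    (hadm : AdmissibleOn s fun z => c z • S z) :
    ∃ V₁ ∈ closure (convexHull ℝ (diskHull E)), ∃ V₂ ∈ closure (convexHull ℝ (diskHull E)),
      ∃ V₃ ∈ closure (convexHull ℝ (diskHull E)),
      stolzBoundaryIntegral s (fun z => c z • S z) =
        (2 * B / (1 - Real.sin s)) • V₁ + (8 * B / (1 - Real.sin s)) • V₂ -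
          (2 * B / (1 - Real.sin s)) • V₃ := by
  have hpi := Real.pi_pos
  have hδ := sub_pos.2 (sin_lt_one_of_lt hs0.le hs)
  have hsin : 0 ≤ Real.sin s := Real.sin_nonneg_of_nonneg_of_le_pi hs0.le (by linarith)
  set K := closure (convexHull ℝ (diskHull E)) with hK
  have hsub : diskHull E ⊆ K := (subset_convexHull ℝ _).trans subset_closure
  have hKc : Convex ℝ K := (convex_convexHull ℝ _).closure
  have hle : Real.pi / 2 - s ≤ 3 * Real.pi / 2 + s := by linarith
  have h0 : (0 : X →L[ℂ] X) ∈ K := hsub (zero_mem_diskHull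
    ⟨_, hS (circlePoint s Real.pi) (Or.inr ⟨Real.pi, ⟨by linarith, by linarith⟩, rfl⟩)⟩)
  have hseg : ∀ θ, (θ = Real.pi / 2 - s ∨ θ = 3 * Real.pi / 2 + s) →
      (2 * B / (1 - Real.sin s))⁻¹ • (∫ t in (0 : ℝ)..1, (circlePoint s θ - 1) •
        (c (1 + t * (circlePoint s θ - 1)) • S (1 + t * (circlePoint s θ - 1)))) ∈ K := by
    intro θ hθ
    have hmem : ∀ t ∈ Set.Ioc (0 : ℝ) 1, 1 + t * (circlePoint s θ - 1) ∈ stolzContour s := by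
      intro t ht
      rcases hθ with rfl | rfl
      · exact Or.inl (Or.inl ⟨t, ht, rfl⟩)
      · exact Or.inl (Or.inr ⟨t, ht, rfl⟩)
    refine inv_smul_integral_mem isClosed_closure hKc h0 zero_le_one (by positivity)
      (a := fun t => 2 * B * (((k : ℝ) + 1) * (1 - (1 - Real.sin s) * t) ^ k))
      (hadm.segment hθ) (Continuous.intervalIntegrable (by fun_prop) _ _) ?_ ?_ ?_
    · intro t ht
      have : 0 ≤ 1 - (1 - Real.sin s) * t := by nlinarith [ht.1, ht.2]
      positivity
    · rw [intervalIntegral.integral_const_mul, ← mul_one_div]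
      exact mul_le_mul_of_nonneg_left (integral_succ_mul_pow_le hδ (by linarith) k) (by positivity)
    · intro t ht
      obtain ⟨V, hV, h⟩ := exists_mem_diskHull_smul (hS _ (hmem t ht))
        (w := (circlePoint s θ - 1) * c (1 + t * (circlePoint s θ - 1)))
        (a := 2 * B * (((k : ℝ) + 1) * (1 - (1 - Real.sin s) * t) ^ k)) (by
          rw [norm_mul, mul_assoc 2 B]
          refine mul_le_mul (norm_circlePoint_sub_one_le hs0.le hs θ) ((hc _ (hmem t ht)).trans ?_)
            (norm_nonneg _) zero_le_two
          have := norm_segment_le hs0.le hs θ ht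
          gcongr)
      exact ⟨V, hsub hV, by rw [← h, smul_smul]⟩
  have harc : (8 * B / (1 - Real.sin s))⁻¹ • (∫ θ in (Real.pi / 2 - s)..(3 * Real.pi / 2 + s),
      (Complex.I * circlePoint s θ) • (c (circlePoint s θ) • S (circlePoint s θ))) ∈ K := by
    refine inv_smul_integral_mem isClosed_closure hKc h0 hle
      (A := 8 * B / (1 - Real.sin s)) (by positivity) (a := fun _ => B / (1 - Real.sin s))
      (hadm.arc hs0.le) intervalIntegrable_const (fun _ _ => (div_pos hB hδ).le) ?_ ?_
    · rw [intervalIntegral.integral_const, smul_eq_mul, mul_div_assoc 8 B]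
      refine mul_le_mul_of_nonneg_right ?_ (div_pos hB hδ).le
      -- the parameter interval of the arc has length `π + 2s < 2π < 8`
      linarith [Real.pi_lt_four]
    · intro θ hθ
      have hmem : circlePoint s θ ∈ stolzContour s :=
        Or.inr ⟨θ, Set.Ioc_subset_Icc_self hθ, rfl⟩
      have hn : ‖circlePoint s θ‖ = Real.sin s := norm_circlePoint hs0.le (by linarith) θ
      obtain ⟨V, hV, h⟩ := exists_mem_diskHull_smul (hS _ hmem)
        (w := Complex.I * circlePoint s θ * c (circlePoint s θ))
        (a := B / (1 - Real.sin s)) (by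
          rw [norm_mul, norm_mul, Complex.norm_I, one_mul, hn, le_div_iff₀ hδ]
          have h1 := hc _ hmem
          rw [hn] at h1
          have h2 := succ_mul_pow_mul_le hsin (Real.sin_le_one s) k
          have h3 : 0 ≤ Real.sin s ^ (k + 1) := by positivity
          calc Real.sin s * ‖c (circlePoint s θ)‖ * (1 - Real.sin s)
              ≤ 1 * (B * (((k : ℝ) + 1) * Real.sin s ^ k)) * (1 - Real.sin s) := by
                gcongr
                exact Real.sin_le_one s
            _ = B * (((k : ℝ) + 1) * Real.sin s ^ k * (1 - Real.sin s)) := by ring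
            _ ≤ B * 1 := by
                gcongr
                linarith
            _ = B := mul_one B)
      exact ⟨V, hsub hV, by rw [← h, smul_smul]⟩
  refine ⟨_, hseg _ (Or.inl rfl), _, harc, _, hseg _ (Or.inr rfl), ?_⟩
  rw [stolzBoundaryIntegral_eq_add_sub, smul_inv_smul₀ (by positivity),
    smul_inv_smul₀ (by positivity), smul_inv_smul₀ (by positivity)]

/-! ### The functional calculus -/

theorem isOpen_stolz (γ : ℝ) : IsOpen (stolz γ) := isOpen_interior

theorem stolz_subset_closedBall (γ : ℝ) : stolz γ ⊆ Metric.closedBall 0 1 := by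
  refine interior_subset.trans (convexHull_min ?_ (convex_closedBall _ _))
  rintro z (hz | hz)
  · rw [Set.mem_singleton_iff.1 hz]
    simp
  · rw [mem_ball_zero_iff] at hz
    rw [mem_closedBall_zero_iff]
    exact hz.le.trans (Real.sin_le_one γ)

namespace IsHZero

variable {γ : ℝ} {f g : ℂ → ℂ}

theorem mul_of_bounded (hf : IsHZero γ f) (hg : DifferentiableOn ℂ g (stolz γ)) {M : ℝ}
    (hM : ∀ z ∈ stolz γ, ‖g z‖ ≤ M) : IsHZero γ (fun z => f z * g z) := by
  obtain ⟨hd, ⟨B, hB⟩, s, c, hs, hc, h⟩ := hf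
  refine ⟨hd.mul hg, ⟨B * M, fun z hz => ?_⟩, s, c * (|M| + 1), hs, by positivity, fun z hz => ?_⟩
  · rw [norm_mul]
    exact mul_le_mul (hB z hz) (hM z hz) (norm_nonneg _) ((norm_nonneg _).trans (hB z hz))
  · rw [norm_mul, mul_right_comm]
    exact mul_le_mul (h z hz) ((hM z hz).trans ((le_abs_self M).trans (by linarith)))
      (norm_nonneg _) (by positivity)

theorem mul_polynomial (hf : IsHZero γ f) (p : Polynomial ℂ) :
    IsHZero γ (fun z => f z * p.eval z) := by
  obtain ⟨M, hM⟩ := (isCompact_closedBall (0 : ℂ) 1).exists_bound_of_continuousOn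
    p.continuous.continuousOn
  exact hf.mul_of_bounded p.differentiable.differentiableOn
    fun z hz => hM z (stolz_subset_closedBall γ hz)

end IsHZero

/-- An `R`-bounded set is bounded: this is the case of a single operator. -/
theorem IsRBounded.exists_norm_le {E : Set (X →L[ℂ] X)} (hE : IsRBounded E) :
    ∃ C : ℝ, 0 ≤ C ∧ ∀ S ∈ E, ‖S‖ ≤ C := by
  obtain ⟨C, hC⟩ := hE
  refine ⟨C, C.2, fun S hS => S.opNorm_le_bound C.2 fun x => ?_⟩
  have h1 : ∀ v : X, radNorm (fun _ => v) 1 = ‖v‖ₑ := by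
    intro v
    have : eLpNorm (radSum (fun _ => v) 1) 2 signMeasure =
        eLpNorm (fun _ : SignSpace => v) 2 signMeasure := by
      refine eLpNorm_congr_norm_ae (Eventually.of_forall fun u => ?_)
      simp only [radSum, Finset.sum_range_one, norm_smul, norm_rademacher, one_mul]
    rw [radNorm, this, eLpNorm_const _ (by norm_num) (IsProbabilityMeasure.ne_zero _)]
    simp
  have h2 := hC 1 (fun _ => S) (fun _ => x) fun _ _ => hS
  rw [h1, h1] at h2
  have h3 := ENNReal.toReal_mono (by finiteness) h2
  simpa using h3

section calculus

variable {T : X →L[ℂ] X} {α γ : ℝ}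

theorem IsRRittOfRType.exists_norm_resolvent_le (hT : IsRRittOfRType T α) {β : ℝ}
    (hβ : β ∈ Set.Ioo α (Real.pi / 2)) :
    ∃ C : ℝ, 0 ≤ C ∧ ∀ z, z ∉ closure (stolz β) → ‖(z - 1) • resolvent T z‖ ≤ C := by
  obtain ⟨C, hC0, hC⟩ := (hT.2 β hβ).exists_norm_le
  exact ⟨C, hC0, fun z hz => hC _ ⟨z, hz, rfl⟩⟩

theorem IsRRittOfRType.mem_resolventSet (hα : 0 < α) (hT : IsRRittOfRType T α) {s : ℝ}
    (hs : α < s) (hs' : s < Real.pi / 2) {z : ℂ} (hz : z ∈ stolzContour s) :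
    z ∈ resolventSet ℂ T := by
  by_contra h
  exact stolzContour_disjoint_closure hα hs hs' hz (hT.1 h)

theorem differentiableOn_resolvent [CompleteSpace X] (T : X →L[ℂ] X) :
    DifferentiableOn ℂ (resolvent T) (resolventSet ℂ T) := fun _ hz =>
  (spectrum.hasDerivAt_resolvent_const_left hz).differentiableAt.differentiableWithinAt

/-- The singularity of `f(z) R(z, T)` at the vertex is integrable for `f ∈ H^∞_0`, uniformly over
the contours `∂B_s` with `s` away from `α`. -/
theorem IsRRittOfRType.exists_bound (hα : 0 < α) (hT : IsRRittOfRType T α) {f : ℂ → ℂ}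
    (hf : IsHZero γ f) (hγ : γ < Real.pi / 2) {a : ℝ} (ha : α < a) (haγ : a < γ) :
    ∃ c σ : ℝ, 0 < σ ∧ ∀ s ∈ Set.Ico a γ, ∀ z ∈ stolzContour s,
      ‖(1 - z) • (f z • resolvent T z)‖ ≤ c * ‖1 - z‖ ^ σ := by
  obtain ⟨β, hβ, hβa⟩ := exists_between ha
  obtain ⟨C, hC0, hC⟩ := hT.exists_norm_resolvent_le (β := β) ⟨hβ, by linarith⟩
  obtain ⟨-, -, σ, c, hσ, hc, h⟩ := hf
  refine ⟨c * C, σ, hσ, fun s hs z hz => ?_⟩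
  have h1 := h z (stolzContour_subset_stolz (by linarith [hs.1]) hs.2 hγ hz)
  have h2 := hC z (stolzContour_disjoint_closure (by linarith) (hβa.trans_le hs.1)
    (hs.2.trans hγ) hz)
  rw [norm_smul, norm_sub_rev] at h2
  rw [smul_comm, norm_smul, norm_smul]
  calc _ ≤ c * ‖1 - z‖ ^ σ * C := mul_le_mul h1 h2 (by positivity) (by positivity)
    _ = _ := by ring

theorem admissibleOn_resolvent [CompleteSpace X] (hα : 0 < α) (hT : IsRRittOfRType T α)
    {f : ℂ → ℂ} (hf : IsHZero γ f) (hγ : γ < Real.pi / 2) {s : ℝ} (hs : s ∈ Set.Ioo α γ) :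
    AdmissibleOn s fun z => f z • resolvent T z := by
  refine ⟨?_, ?_⟩
  · exact (hf.1.continuousOn.mono
      (stolzContour_subset_stolz (by linarith [hs.1]) hs.2 hγ)).smul
      ((differentiableOn_resolvent T).continuousOn.mono fun z hz =>
        hT.mem_resolventSet hα hs.1 (hs.2.trans hγ) hz)
  · obtain ⟨c, σ, hσ, h⟩ := hT.exists_bound hα hf hγ hs.1 hs.2
    exact ⟨c, σ, hσ, h s ⟨le_rfl, hs.2⟩⟩

/-- The operator `φ(T)` does not depend on the contour. -/
theorem hInfCalc_congr [CompleteSpace X] (hα : 0 < α) (hT : IsRRittOfRType T α)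
    {f : ℂ → ℂ} (hf : IsHZero γ f) (hγ : γ < Real.pi / 2) {a b : ℝ}
    (ha : a ∈ Set.Ioo α γ) (hb : b ∈ Set.Ioo α γ) : hInfCalc T a f = hInfCalc T b f := by
  wlog hab : a ≤ b generalizing a b
  · exact (this hb ha (le_of_not_ge hab)).symm
  obtain ⟨c, σ, hσ, h⟩ := hT.exists_bound hα hf hγ ha.1 ha.2
  unfold hInfCalc
  rw [stolzBoundaryIntegral_congr (F := fun z => f z • resolvent T z)
    (U := stolz γ ∩ resolventSet ℂ T)
    ((isOpen_stolz γ).inter (spectrum.isOpen_resolventSet T))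
    ((hf.1.mono Set.inter_subset_left).smul
      ((differentiableOn_resolvent T).mono Set.inter_subset_right))
    (hα.trans ha.1).le hab (hb.2.trans hγ) hσ (fun s hs z hz => ⟨?_, ?_⟩)
    (fun s hs z hz => h s ⟨hs.1, hs.2.trans_lt hb.2⟩ z hz)]
  · exact stolzContour_subset_stolz (by linarith [hs.1, ha.1]) (hs.2.trans_lt hb.2) hγ hz
  · exact hT.mem_resolventSet hα (ha.1.trans_le hs.1) (hs.2.trans_lt (hb.2.trans hγ)) hz

theorem exists_bound_smul_one {f : ℂ → ℂ} (hf : IsHZero γ f) :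
    ∃ c σ : ℝ, 0 < σ ∧ ∀ z ∈ stolz γ,
      ‖(1 - z) • (f z • (1 : X →L[ℂ] X))‖ ≤ c * ‖1 - z‖ ^ σ := by
  obtain ⟨-, -, σ, c, hσ, hc, h⟩ := hf
  refine ⟨c * ‖(1 : X →L[ℂ] X)‖, σ + 1, by linarith, fun z hz => ?_⟩
  rw [norm_smul, norm_smul, Real.rpow_add_one' (norm_nonneg _) (by linarith)]
  calc _ ≤ ‖1 - z‖ * (c * ‖1 - z‖ ^ σ * ‖(1 : X →L[ℂ] X)‖) := by
        gcongr
        exact h z hz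
    _ = _ := by ring

theorem admissibleOn_smul_one {f : ℂ → ℂ} (hf : IsHZero γ f) (hγ : γ < Real.pi / 2) {s : ℝ}
    (hs0 : 0 ≤ s) (hs : s < γ) : AdmissibleOn s fun z => f z • (1 : X →L[ℂ] X) := by
  have hsub := stolzContour_subset_stolz hs0 hs hγ
  obtain ⟨c, σ, hσ, h⟩ := exists_bound_smul_one (X := X) hf
  exact ⟨(hf.1.continuousOn.mono hsub).smul continuousOn_const, c, σ, hσ,
    fun z hz => h z (hsub hz)⟩

/-- Cauchy's theorem for scalar functions: shrinking `s` to `0` degenerates `∂B_s` to a segment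
that is traversed twice. -/
theorem stolzBoundaryIntegral_smul_one [CompleteSpace X] {f : ℂ → ℂ} (hf : IsHZero γ f)
    (hγ : γ < Real.pi / 2) {s : ℝ} (hs0 : 0 ≤ s) (hs : s < γ) :
    stolzBoundaryIntegral s (fun z => f z • (1 : X →L[ℂ] X)) = 0 := by
  obtain ⟨c, σ, hσ, h⟩ := exists_bound_smul_one (X := X) hf
  have hsub : ∀ r ∈ Set.Icc 0 s, stolzContour r ⊆ stolz γ := fun r hr =>
    stolzContour_subset_stolz hr.1 (hr.2.trans_lt hs) hγ
  rw [← stolzBoundaryIntegral_congr (isOpen_stolz γ) (hf.1.smul (differentiableOn_const _))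
    le_rfl hs0 (hs.trans hγ) hσ hsub fun r hr z hz => h z (hsub r hr hz)]
  exact stolzBoundaryIntegral_zero _

theorem resolvent_mul_eq {z : ℂ} (hz : z ∈ resolventSet ℂ T) :
    resolvent T z * T = z • resolvent T z - 1 := by
  have h : resolvent T z * (algebraMap ℂ _ z - T) = 1 := Ring.inverse_mul_cancel _ hz
  rw [mul_sub, ← Algebra.commutes, ← Algebra.smul_def] at h
  rw [← h]
  abel

theorem mul_resolvent_eq {z : ℂ} (hz : z ∈ resolventSet ℂ T) :
    T * resolvent T z = z • resolvent T z - 1 := by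
  have h : (algebraMap ℂ _ z - T) * resolvent T z = 1 := Ring.mul_inverse_cancel _ hz
  rw [sub_mul, ← Algebra.smul_def] at h
  rw [← h]
  abel

/-- Multiplication of `f` by `z` amounts to a multiplication by `T`, on the left or on the right as
encoded by `L`: the two integrands differ by `f(z) • 1`, whose integral vanishes. -/
theorem stolzBoundaryIntegral_id_mul [CompleteSpace X] (hα : 0 < α) (hT : IsRRittOfRType T α)
    {f : ℂ → ℂ} (hf : IsHZero γ f) (hγ : γ < Real.pi / 2) {s : ℝ} (hs : s ∈ Set.Ioo α γ)
    (L : (X →L[ℂ] X) →L[ℂ] (X →L[ℂ] X))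
    (hL : ∀ z ∈ resolventSet ℂ T, L (resolvent T z) = z • resolvent T z - 1) :
    hInfCalc T s (fun z => f z * z) = L (hInfCalc T s f) := by
  have hs0 : 0 ≤ s := by linarith [hs.1]
  have hadm := admissibleOn_resolvent hα hT hf hγ hs
  have hadm' : AdmissibleOn s fun z => L (f z • resolvent T z) := by
    obtain ⟨hc, c, σ, hσ, h⟩ := hadm
    refine ⟨L.continuous.comp_continuousOn hc, ‖L‖ * c, σ, hσ, fun z hz => ?_⟩
    rw [← map_smul, mul_assoc]
    exact (L.le_opNorm _).trans (mul_le_mul_of_nonneg_left (h z hz) (norm_nonneg _))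
  have heq : Set.EqOn (fun z => (f z * z) • resolvent T z)
      (fun z => L (f z • resolvent T z) + f z • (1 : X →L[ℂ] X)) (stolzContour s) := by
    intro z hz
    simp only [map_smul]
    rw [hL z (hT.mem_resolventSet hα hs.1 (hs.2.trans hγ) hz), smul_sub, sub_add_cancel,
      smul_smul]
  unfold hInfCalc
  rw [stolzBoundaryIntegral_congr_contour hs0 heq,
    hadm'.integral_add (admissibleOn_smul_one hf hγ hs0 hs.2) hs0,
    stolzBoundaryIntegral_smul_one hf hγ hs0 hs.2, add_zero, hadm.integral_clm hs0, map_smul]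

theorem hInfCalc_mul_id [CompleteSpace X] (hα : 0 < α) (hT : IsRRittOfRType T α)
    {f : ℂ → ℂ} (hf : IsHZero γ f) (hγ : γ < Real.pi / 2) {s : ℝ} (hs : s ∈ Set.Ioo α γ) :
    hInfCalc T s (fun z => f z * z) = hInfCalc T s f * T :=
  stolzBoundaryIntegral_id_mul hα hT hf hγ hs ((ContinuousLinearMap.mul ℂ (X →L[ℂ] X)).flip T)
    fun _ hz => resolvent_mul_eq hz

theorem commute_hInfCalc [CompleteSpace X] (hα : 0 < α) (hT : IsRRittOfRType T α)
    {f : ℂ → ℂ} (hf : IsHZero γ f) (hγ : γ < Real.pi / 2) {s : ℝ} (hs : s ∈ Set.Ioo α γ) :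
    Commute T (hInfCalc T s f) :=
  (stolzBoundaryIntegral_id_mul hα hT hf hγ hs (ContinuousLinearMap.mul ℂ (X →L[ℂ] X) T)
    fun _ hz => mul_resolvent_eq hz).symm.trans (hInfCalc_mul_id hα hT hf hγ hs)

/-- The calculus is multiplicative with respect to polynomials. -/
theorem hInfCalc_mul_polynomial [CompleteSpace X] (hα : 0 < α) (hT : IsRRittOfRType T α)
    {f : ℂ → ℂ} (hf : IsHZero γ f) (hγ : γ < Real.pi / 2) {s : ℝ} (hs : s ∈ Set.Ioo α γ)
    (p : Polynomial ℂ) :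
    hInfCalc T s (fun z => f z * p.eval z) = hInfCalc T s f * Polynomial.aeval T p := by
  have hs0 : 0 ≤ s := by linarith [hs.1]
  induction p using Polynomial.induction_on with
  | C a =>
    have : ∀ z, (f z * (Polynomial.C a).eval z) • resolvent T z =
        a • (f z • resolvent T z) := fun z => by
      rw [Polynomial.eval_C, mul_comm, mul_smul]
    unfold hInfCalc
    simp only [this]
    rw [stolzBoundaryIntegral_const_smul, Polynomial.aeval_C, ← Algebra.commutes,
      ← Algebra.smul_def, smul_comm]
  | add p q hp hq =>
    have : ∀ z, (f z * (p + q).eval z) • resolvent T z =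
        (f z * p.eval z) • resolvent T z + (f z * q.eval z) • resolvent T z := fun z => by
      rw [Polynomial.eval_add, mul_add, add_smul]
    unfold hInfCalc at hp hq ⊢
    simp only [this]
    rw [(admissibleOn_resolvent hα hT (hf.mul_polynomial p) hγ hs).integral_add
      (admissibleOn_resolvent hα hT (hf.mul_polynomial q) hγ hs) hs0, smul_add, hp, hq, map_add,
      mul_add]
  | monomial n a h =>
    have e : ∀ z, f z * (Polynomial.C a * Polynomial.X ^ (n + 1)).eval z =
        (f z * (Polynomial.C a * Polynomial.X ^ n).eval z) * z := fun z => by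
      simp only [Polynomial.eval_mul, Polynomial.eval_C, Polynomial.eval_pow, Polynomial.eval_X]
      ring
    simp only [e]
    rw [hInfCalc_mul_id hα hT (hf.mul_polynomial _) hγ hs, h, pow_succ, ← mul_assoc
      (Polynomial.C a), map_mul _ (_ * _) Polynomial.X, Polynomial.aeval_X, mul_assoc]

end calculus

/-! ### The bounded calculus -/

/-- The three terms of degrees `k`, `k + 1`, `k + 2` by which the coefficients of degrees `3k`,
`3k + 1`, `3k + 2` of the series `∑ (n+2 choose 2) z ^ n` are collected, divided by `k + 1`. -/
def weightPoly (k : ℕ) : Polynomial ℂ :=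
  ∑ r ∈ Finset.range 3,
    Polynomial.C (((3 * k + r + 2).choose 2 : ℂ) / (k + 1)) * Polynomial.X ^ (k + r)

/-- A partial sum of the expansion `1 = (1 - z)^3 ∑ (n+2 choose 2) z ^ n`, grouped by threes so that
each summand contains the square of `z ^ k (1 - z)`. -/
def approxPoly (N : ℕ) : Polynomial ℂ :=
  ∑ k ∈ Finset.range N, Polynomial.C ((k : ℂ) + 1) *
    ((Polynomial.X ^ k * (1 - Polynomial.X)) * (Polynomial.X ^ k * (1 - Polynomial.X))) *
      (weightPoly k * (1 - Polynomial.X))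

theorem eval_approxPoly (N : ℕ) (z : ℂ) : (approxPoly N).eval z =
    (1 - z) ^ 3 * ∑ n ∈ Finset.range (3 * N), ((n + 2).choose 2 : ℂ) * z ^ n := by
  induction N with
  | zero => simp [approxPoly]
  | succ N ih =>
    have h : approxPoly (N + 1) = approxPoly N + Polynomial.C ((N : ℂ) + 1) *
        ((Polynomial.X ^ N * (1 - Polynomial.X)) * (Polynomial.X ^ N * (1 - Polynomial.X))) *
          (weightPoly N * (1 - Polynomial.X)) := Finset.sum_range_succ _ _
    have hN : (N : ℂ) + 1 ≠ 0 := Nat.cast_add_one_ne_zero N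
    rw [h, Polynomial.eval_add, ih, show 3 * (N + 1) = 3 * N + 1 + 1 + 1 by ring,
      Finset.sum_range_succ, Finset.sum_range_succ, Finset.sum_range_succ]
    simp only [weightPoly, Finset.sum_range_succ, Finset.sum_range_zero, Polynomial.eval_mul,
      Polynomial.eval_add, Polynomial.eval_C, Polynomial.eval_pow, Polynomial.eval_X,
      Polynomial.eval_sub, Polynomial.eval_one, Polynomial.eval_zero]
    field_simp
    ring

theorem norm_eval_weightPoly_le (k : ℕ) {z : ℂ} (hz : ‖z‖ ≤ 1) :
    ‖(weightPoly k).eval z‖ ≤ 18 * (((k : ℝ) + 1) * ‖z‖ ^ k) := by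
  have h1 : ∀ r ∈ Finset.range 3,
      ‖(Polynomial.C (((3 * k + r + 2).choose 2 : ℂ) / (k + 1)) * Polynomial.X ^ (k + r)).eval z‖ ≤
        6 * (((k : ℝ) + 1) * ‖z‖ ^ k) := by
    intro r hr
    have hr' : r ≤ 2 := Nat.lt_succ_iff.1 (Finset.mem_range.1 hr)
    have hk : (0 : ℝ) < (k : ℝ) + 1 := by positivity
    have h2 : (((3 * k + r + 2).choose 2 : ℕ) : ℝ) ≤ 6 * ((k : ℝ) + 1) ^ 2 := by
      have h3 : (3 * k + r + 2).choose 2 ≤ (3 * k + 4).choose 2 :=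
        Nat.choose_le_choose 2 (by omega)
      have h4 : (((3 * k + 4).choose 2 : ℕ) : ℝ) = (3 * k + 4) * (3 * k + 3) / 2 := by
        rw [Nat.cast_choose_two]
        push_cast
        ring
      have h5 : (((3 * k + r + 2).choose 2 : ℕ) : ℝ) ≤ ((3 * k + 4).choose 2 : ℕ) := by
        exact_mod_cast h3
      rw [h4] at h5
      nlinarith [(Nat.cast_nonneg k : (0 : ℝ) ≤ k)]
    rw [Polynomial.eval_mul, Polynomial.eval_C, Polynomial.eval_pow, Polynomial.eval_X, norm_mul,
      norm_div, norm_pow, Complex.norm_natCast]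
    have h6 : ‖(k : ℂ) + 1‖ = (k : ℝ) + 1 := by
      rw [← Nat.cast_succ, Complex.norm_natCast, Nat.cast_succ]
    have h7 : ‖z‖ ^ (k + r) ≤ ‖z‖ ^ k := pow_le_pow_of_le_one (norm_nonneg z) hz (by omega)
    rw [h6, ← mul_assoc]
    refine mul_le_mul ?_ h7 (by positivity) (by positivity)
    rw [div_le_iff₀ hk]
    linarith
  rw [weightPoly, Polynomial.eval_finsetSum]
  refine (norm_sum_le_of_le _ h1).trans (le_of_eq ?_)
  rw [Finset.sum_const, Finset.card_range, nsmul_eq_mul]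
  push_cast
  ring

section contour

variable {s : ℝ}

theorem tendsto_eval_approxPoly (hs0 : 0 ≤ s) (hs : s < Real.pi / 2) {z : ℂ}
    (hz : z ∈ stolzContour s) : Tendsto (fun N => (approxPoly N).eval z) atTop (𝓝 1) := by
  have h1 := hasSum_choose_mul_geometric_of_norm_lt_one 2
    (norm_lt_one_of_mem_stolzContour hs0 hs hz)
  have h2 := (h1.tendsto_sum_nat.comp
    (tendsto_id.const_mul_atTop' (zero_lt_three : 0 < 3))).const_mul ((1 - z) ^ 3)
  have h3 : (1 - z) ^ 3 ≠ 0 :=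
    pow_ne_zero _ (sub_ne_zero.2 (ne_one_of_mem_stolzContour hs0 hs hz).symm)
  rw [mul_one_div_cancel h3] at h2
  simp only [eval_approxPoly]
  exact h2

theorem norm_eval_approxPoly_le (hs0 : 0 ≤ s) (hs : s < Real.pi / 2) {z : ℂ}
    (hz : z ∈ stolzContour s) (N : ℕ) :
    ‖(approxPoly N).eval z‖ ≤ (2 / (1 - Real.sin s)) ^ 3 := by
  have hδ := sub_pos.2 (sin_lt_one_of_lt hs0 hs)
  have hlt := norm_lt_one_of_mem_stolzContour hs0 hs hz
  have h1 := hasSum_choose_mul_geometric_of_norm_lt_one (r := ‖z‖) 2 (by simpa using hlt)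
  have h2 : ‖∑ n ∈ Finset.range (3 * N), ((n + 2).choose 2 : ℂ) * z ^ n‖ ≤
      1 / (1 - ‖z‖) ^ 3 := by
    refine (norm_sum_le _ _).trans ?_
    simp only [norm_mul, norm_pow, Complex.norm_natCast]
    exact sum_le_hasSum _ (fun n _ => by positivity) h1
  have h3 : ‖1 - z‖ ≤ 2 / (1 - Real.sin s) * (1 - ‖z‖) := by
    rw [div_mul_eq_mul_div, le_div_iff₀ hδ]
    exact norm_one_sub_le_of_mem_stolzContour hs0 hs hz
  have hpos : 0 < 1 - ‖z‖ := sub_pos.2 hlt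
  rw [eval_approxPoly, norm_mul, norm_pow]
  calc _ ≤ (2 / (1 - Real.sin s) * (1 - ‖z‖)) ^ 3 * (1 / (1 - ‖z‖) ^ 3) := by gcongr
    _ = _ := by
      rw [mul_pow]
      field_simp

end contour

/-- `φ(T) = lim φ(T) P_N(T)` although `P_N(T)` need not converge: `φ` vanishes at the vertex, so
dominated convergence applies to the contour integrals. -/
theorem tendsto_hInfCalc_approxPoly [CompleteSpace X] {T : X →L[ℂ] X} {α γ : ℝ} (hα : 0 < α)
    (hT : IsRRittOfRType T α) {f : ℂ → ℂ} (hf : IsHZero γ f) (hγ : γ < Real.pi / 2) {s : ℝ}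
    (hs : s ∈ Set.Ioo α γ) :
    Tendsto (fun N => hInfCalc T s fun z => f z * (approxPoly N).eval z) atTop
      (𝓝 (hInfCalc T s f)) := by
  have hs0 : 0 ≤ s := by linarith [hs.1]
  have hs1 : s < Real.pi / 2 := hs.2.trans hγ
  obtain ⟨c, σ, hσ, hb⟩ := (admissibleOn_resolvent hα hT hf hγ hs).2
  refine Tendsto.const_smul (tendsto_stolzBoundaryIntegral
    (c := (2 / (1 - Real.sin s)) ^ 3 * c) hs0 hs1 hσ (fun N => ?_) (fun N z hz => ?_)
    fun z hz => ?_) _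
  · exact (admissibleOn_resolvent hα hT (hf.mul_polynomial _) hγ hs).1
  · have e : (1 - z) • ((f z * (approxPoly N).eval z) • resolvent T z) =
        (approxPoly N).eval z • ((1 - z) • (f z • resolvent T z)) := by
      rw [mul_comm, mul_smul, smul_comm]
    have hδ := sub_pos.2 (sin_lt_one_of_lt hs0 hs1)
    rw [e, norm_smul, mul_assoc]
    exact mul_le_mul (norm_eval_approxPoly_le hs0 hs1 hz N) (hb z hz) (norm_nonneg _)
      (by positivity)
  · have h := ((tendsto_eval_approxPoly hs0 hs1 hz).const_mul (f z)).smul_const (resolvent T z)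
    rwa [mul_one] at h

/-- `R`-boundedness of a sequence of contour integrals whose densities are `O((k + 1) |z| ^ k)`. -/
theorem radNorm_stolzBoundaryIntegral_le [CompleteSpace X] {s B : ℝ} (hs0 : 0 < s)
    (hs : s < Real.pi / 2) (hB : 0 < B) {C : ℝ≥0} {E : Set (X →L[ℂ] X)} (hE : RBoundedBy C E)
    {c : ℕ → ℂ → ℂ} {S : ℂ → X →L[ℂ] X} (hS : ∀ z ∈ stolzContour s, S z ∈ E)
    (hc : ∀ k, ∀ z ∈ stolzContour s, ‖c k z‖ ≤ B * (((k : ℝ) + 1) * ‖z‖ ^ k))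
    (hadm : ∀ k, AdmissibleOn s fun z => c k z • S z) (x : ℕ → X) (n : ℕ) :
    radNorm (fun k => stolzBoundaryIntegral s (fun z => c k z • S z) (x k)) n ≤
      ENNReal.ofReal (12 * B / (1 - Real.sin s)) * ((2 * C : ℝ≥0) * radNorm x n) := by
  have hδ := sub_pos.2 (sin_lt_one_of_lt hs0.le hs)
  have hK := hE.diskHull.closure_convexHull
  choose V₁ h₁ V₂ h₂ V₃ h₃ hV using fun k =>
    exists_stolzBoundaryIntegral_eq hs0 hs hB hS (hc k) (hadm k)
  set a : ℝ := 2 * B / (1 - Real.sin s) with ha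
  set b : ℝ := 8 * B / (1 - Real.sin s) with hb
  have ha0 : 0 ≤ a := by positivity
  have hb0 : 0 ≤ b := by positivity
  have e : (fun k => stolzBoundaryIntegral s (fun z => c k z • S z) (x k)) = fun k =>
      (a : ℂ) • V₁ k (x k) + ((b : ℂ) • V₂ k (x k) + ((-a : ℝ) : ℂ) • V₃ k (x k)) := by
    funext k
    rw [hV k]
    simp only [sub_apply, add_apply, smul_apply, Complex.coe_smul, neg_smul]
    abel
  rw [e]
  refine (radNorm_add_le _ _ n).trans
    ((add_le_add le_rfl (radNorm_add_le _ _ n)).trans ?_)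
  rw [radNorm_const_smul, radNorm_const_smul, radNorm_const_smul]
  have hcast : ∀ t : ℝ, ‖(t : ℂ)‖ₑ = ENNReal.ofReal |t| := fun t => by
    rw [← ofReal_norm, Complex.norm_real, Real.norm_eq_abs]
  rw [hcast, hcast, hcast, abs_neg, abs_of_nonneg ha0, abs_of_nonneg hb0]
  have e2 : 12 * B / (1 - Real.sin s) = a + (b + a) := by rw [ha, hb]; ring
  rw [e2, ENNReal.ofReal_add ha0 (by positivity), ENNReal.ofReal_add hb0 ha0, add_mul, add_mul]
  gcongr
  · exact hK n V₁ x fun k _ => h₁ k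
  · exact hK n V₂ x fun k _ => h₂ k
  · exact hK n V₃ x fun k _ => h₃ k

/-- The `k`-th vector of the series that defines the square function `‖x‖_{T,1}`. -/
def squareVec (T : X →L[ℂ] X) (x : X) (k : ℕ) : X :=
  ((k : ℝ) + 1) ^ (((1 : ℕ) : ℝ) - 1 / 2) • ((T ^ k * (1 - T) ^ 1 : X →L[ℂ] X) x)

theorem squareVec_eq (T : X →L[ℂ] X) (x : X) (k : ℕ) :
    squareVec T x k = ((k : ℝ) + 1) ^ (((1 : ℕ) : ℝ) - 1 / 2) • (T ^ k) (x - T x) := by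
  rw [squareVec, pow_one]
  rfl

theorem pow_succ_apply_eq (T : X →L[ℂ] X) (k : ℕ) (x : X) : (T ^ (k + 1)) x = T ((T ^ k) x) := by
  rw [pow_succ']
  rfl

theorem dualOp_pow_apply (T : X →L[ℂ] X) (k : ℕ) (y : StrongDual ℂ X) (v : X) :
    (dualOp T ^ k) y v = y ((T ^ k) v) := by
  induction k generalizing v with
  | zero => rfl
  | succ k ih =>
    rw [pow_succ_apply_eq, pow_succ T k, mul_apply_eq_comp]
    exact ih (T v)

theorem squareVec_dualOp_apply (T : X →L[ℂ] X) (k : ℕ) (y : StrongDual ℂ X) (v : X) :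
    squareVec (dualOp T) y k v =
      ((k : ℝ) + 1) ^ (((1 : ℕ) : ℝ) - 1 / 2) • y ((T ^ k * (1 - T)) v) := by
  have hcomm : T ^ k * (1 - T) = (1 - T) * T ^ k :=
    ((Commute.one_right _).sub_right ((Commute.refl T).pow_left k)).eq
  rw [squareVec_eq, smul_apply, dualOp_pow_apply, hcomm, mul_apply_eq_comp,
    sub_apply, sub_apply, map_sub]
  rfl

/-- The weights of the square functions multiply to the factor `k + 1` of `approxPoly`. -/
theorem weight_mul_self (k : ℕ) :
    ((k : ℝ) + 1) ^ (((1 : ℕ) : ℝ) - 1 / 2) * ((k : ℝ) + 1) ^ (((1 : ℕ) : ℝ) - 1 / 2) =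
      (k : ℝ) + 1 := by
  rw [← Real.rpow_add (by positivity)]
  norm_num

/-- The factorization of `φ(T) P_N(T)` through the two square functions. -/
theorem apply_hInfCalc_approxPoly [CompleteSpace X] {T : X →L[ℂ] X} {α γ : ℝ} (hα : 0 < α)
    (hT : IsRRittOfRType T α) {f : ℂ → ℂ} (hf : IsHZero γ f) (hγ : γ < Real.pi / 2) {s : ℝ}
    (hs : s ∈ Set.Ioo α γ) (x : X) (y : StrongDual ℂ X) (N : ℕ) :
    y (hInfCalc T s (fun z => f z * (approxPoly N).eval z) x) =
      ∑ k ∈ Finset.range N,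
        squareVec (dualOp T) y k
          (hInfCalc T s (fun z => f z * (weightPoly k * (1 - Polynomial.X)).eval z)
            (squareVec T x k)) := by
  rw [hInfCalc_mul_polynomial hα hT hf hγ hs, approxPoly, map_sum, Finset.mul_sum, sum_apply,
    map_sum]
  refine Finset.sum_congr rfl fun k _ => ?_
  rw [hInfCalc_mul_polynomial hα hT hf hγ hs]
  set P := hInfCalc T s f with hP
  set W := Polynomial.aeval T (weightPoly k * (1 - Polynomial.X)) with hW
  set D : X →L[ℂ] X := T ^ k * (1 - T) with hD
  have hDa : Polynomial.aeval T ((Polynomial.X ^ k * (1 - Polynomial.X) : Polynomial ℂ)) = D := by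
    simp [hD]
  have hDP : Commute D P := by
    have h := commute_hInfCalc hα hT hf hγ hs
    exact (h.pow_left k).mul_left ((Commute.one_left _).sub_left h)
  -- one of the two factors `D` is moved to the left, to act on `y`
  have hDW : Commute D W := by
    rw [← hDa, hW]
    exact (Commute.all _ _).map (Polynomial.aeval T)
  have hop : P * (Polynomial.aeval T) (Polynomial.C ((k : ℂ) + 1) *
      ((Polynomial.X ^ k * (1 - Polynomial.X)) * (Polynomial.X ^ k * (1 - Polynomial.X))) *
        (weightPoly k * (1 - Polynomial.X))) = ((k : ℂ) + 1) • (D * (P * W * D)) := by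
    rw [map_mul, map_mul, map_mul, hDa, ← hW, Polynomial.aeval_C, ← Algebra.smul_def,
      smul_mul_assoc, mul_smul_comm]
    congr 1
    clear_value D P W
    rw [show D * (P * W * D) = (D * P) * (W * D) by simp only [mul_assoc], hDP.eq, ← hDW.eq]
    simp only [mul_assoc]
  rw [hop, smul_apply, squareVec_dualOp_apply, squareVec, pow_one, ← hD]
  have hr : (P * W) ((((k : ℝ) + 1) ^ (((1 : ℕ) : ℝ) - 1 / 2)) • D x) =
      (((k : ℝ) + 1) ^ (((1 : ℕ) : ℝ) - 1 / 2)) • (P * W) (D x) :=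
    map_real_smul (P * W) (P * W).continuous _ _
  rw [hr, map_real_smul D D.continuous, map_real_smul y y.continuous, smul_smul, weight_mul_self,
    map_smul, ← Complex.coe_smul]
  push_cast
  rfl

/-- The estimate of the calculus on a fixed contour, the bound `M` for `φ` being positive. -/
theorem norm_hInfCalc_le [CompleteSpace X] {T : X →L[ℂ] X} {α γ : ℝ} (hα : 0 < α)
    (hT : IsRRittOfRType T α) (hsq : SquareFunctionEstimate T 1)
    (hsq_dual : SquareFunctionEstimate (dualOp T) 1) (hγ : γ < Real.pi / 2) {s : ℝ}
    (hs : s ∈ Set.Ioo α γ) :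
    ∃ K : ℝ, 0 ≤ K ∧ ∀ f : ℂ → ℂ, IsHZero γ f → ∀ M : ℝ, 0 < M → (∀ z ∈ stolz γ, ‖f z‖ ≤ M) →
      ‖hInfCalc T s f‖ ≤ K * M := by
  have hs0 : 0 < s := hα.trans hs.1
  have hs1 : s < Real.pi / 2 := hs.2.trans hγ
  have hδ := sub_pos.2 (sin_lt_one_of_lt hs0.le hs1)
  obtain ⟨β, hβ, hβs⟩ := exists_between hs.1
  obtain ⟨C, hC⟩ := hT.2 β ⟨hβ, hβs.trans hs1⟩
  obtain ⟨Cx, hx⟩ := hsq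
  obtain ⟨Cy, hy⟩ := hsq_dual
  refine ⟨Cy * (12 * 18 / (1 - Real.sin s) * (2 * C * Cx)), by positivity,
    fun f hf M hM hfM => ?_⟩
  have hsub := stolzContour_subset_stolz hs0.le hs.2 hγ
  set U : ℕ → X →L[ℂ] X := fun k =>
    hInfCalc T s (fun z => f z * (weightPoly k * (1 - Polynomial.X)).eval z) with hU
  have hUr : ∀ (v : ℕ → X) (n : ℕ), radNorm (fun k => U k (v k)) n ≤
      ENNReal.ofReal (12 * (18 * M) / (1 - Real.sin s)) * ((2 * C : ℝ≥0) * radNorm v n) := by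
    intro v n
    have e : ∀ k z, (f z * (weightPoly k * (1 - Polynomial.X)).eval z) • resolvent T z =
        (-(f z * (weightPoly k).eval z)) • ((z - 1) • resolvent T z) := by
      intro k z
      rw [smul_smul]
      congr 1
      simp only [Polynomial.eval_mul, Polynomial.eval_sub, Polynomial.eval_one,
        Polynomial.eval_X]
      ring
    have h := radNorm_stolzBoundaryIntegral_le hs0 hs1 (B := 18 * M) (by positivity) hC
      (c := fun k z => -(f z * (weightPoly k).eval z)) (S := fun z => (z - 1) • resolvent T z)
      (fun z hz => ⟨z, stolzContour_disjoint_closure (hα.trans hβ) hβs hs1 hz, rfl⟩)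
      (fun k z hz => by
        rw [norm_neg, norm_mul, mul_comm 18 M, mul_assoc]
        exact mul_le_mul (hfM z (hsub hz)) (norm_eval_weightPoly_le k
          (norm_lt_one_of_mem_stolzContour hs0.le hs1 hz).le) (norm_nonneg _) hM.le)
      (fun k => by
        simp only [← e]
        exact admissibleOn_resolvent hα hT (hf.mul_polynomial _) hγ hs) v n
    refine le_trans ?_ h
    simp only [hU, hInfCalc, smul_apply, e]
    rw [radNorm_const_smul]
    refine mul_le_of_le_one_left' ?_
    have h2 : ‖(2 * Real.pi * Complex.I : ℂ)⁻¹‖ ≤ 1 := by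
      rw [norm_inv, norm_mul, norm_mul, Complex.norm_I, Complex.norm_real, mul_one,
        Real.norm_of_nonneg Real.pi_pos.le, Complex.norm_ofNat]
      exact inv_le_one_of_one_le₀ (by linarith [Real.pi_gt_three])
    rw [← ofReal_norm]
    exact ENNReal.ofReal_le_one.2 h2
  have hbound : ∀ (x : X) (y : StrongDual ℂ X) (N : ℕ),
      ‖y (hInfCalc T s (fun z => f z * (approxPoly N).eval z) x)‖ ≤
        Cy * (12 * 18 / (1 - Real.sin s) * (2 * C * Cx)) * M * ‖x‖ * ‖y‖ := by
    intro x y N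
    rw [apply_hInfCalc_approxPoly hα hT hf hγ hs]
    have h1 := enorm_sum_apply_le (fun k => U k (squareVec T x k)) (squareVec (dualOp T) y) N
    have h2 : radNorm (squareVec (dualOp T) y) N ≤ Cy * ‖y‖ₑ :=
      (radNorm_le_radSeriesNorm _ N).trans (hy y)
    have h3 : radNorm (squareVec T x) N ≤ Cx * ‖x‖ₑ :=
      (radNorm_le_radSeriesNorm _ N).trans (hx x)
    have h4 := h1.trans (mul_le_mul' h2 ((hUr _ N).trans
      (mul_le_mul' le_rfl (mul_le_mul' le_rfl h3))))
    have h5 := ENNReal.toReal_mono (by finiteness) h4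
    have hq : 0 ≤ 12 * (18 * M) / (1 - Real.sin s) := by positivity
    simp only [ENNReal.toReal_mul, toReal_enorm, ENNReal.coe_toReal,
      ENNReal.toReal_ofReal hq] at h5
    refine h5.trans (le_of_eq ?_)
    push_cast
    ring
  refine ContinuousLinearMap.opNorm_le_bound _ (by positivity) fun x => ?_
  refine NormedSpace.norm_le_dual_bound ℂ _ (by positivity) fun y => ?_
  have hlim : Tendsto (fun N => y (hInfCalc T s (fun z => f z * (approxPoly N).eval z) x)) atTop
      (𝓝 (y (hInfCalc T s f x))) :=
    (y.continuous.tendsto _).comp (((ContinuousLinearMap.apply ℂ X x).continuous.tendsto _).comp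
      (tendsto_hInfCalc_approxPoly hα hT hf hγ hs))
  exact le_of_tendsto hlim.norm (Eventually.of_forall fun N => hbound x y N)

end

end RittCalc

theorem theorem7p3 {X : Type*} [NormedAddCommGroup X] [NormedSpace ℂ X] [CompleteSpace X]
    (T : X →L[ℂ] X) (α : ℝ) (hα : α ∈ Set.Ioo 0 (Real.pi / 2))
    (hT : RittCalc.IsRRittOfRType T α)
    (hsq : RittCalc.SquareFunctionEstimate T 1)
    (hsq_dual : RittCalc.SquareFunctionEstimate (RittCalc.dualOp T) 1) :
    ∀ γ ∈ Set.Ioo α (Real.pi / 2), RittCalc.HasBoundedCalculus T α γ := by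
  intro γ hγ
  obtain ⟨s, hs⟩ := exists_between hγ.1
  obtain ⟨K, hK0, hK⟩ := RittCalc.norm_hInfCalc_le hα.1 hT hsq hsq_dual hγ.2 hs
  refine ⟨K + 1, by positivity, fun φ hφ β hβ => ?_⟩
  rw [RittCalc.hInfCalc_congr hα.1 hT hφ hγ.2 hβ hs]
  obtain ⟨B, hB⟩ := hφ.2.1
  have hle : ∀ z ∈ RittCalc.stolz γ, ‖φ z‖ ≤ RittCalc.supNorm γ φ := fun z hz =>
    le_ciSup (f := fun z : RittCalc.stolz γ => ‖φ z‖)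
      ⟨B, by rintro _ ⟨w, rfl⟩; exact hB w w.2⟩ ⟨z, hz⟩
  have h0 : 0 ≤ RittCalc.supNorm γ φ := Real.iSup_nonneg fun _ => norm_nonneg _
  -- `hK` asks for a positive bound of `φ`, whereas the supremum of `‖φ‖` may be `0`
  refine le_of_forall_pos_le_add fun ε hε => ?_
  have hpos : 0 < RittCalc.supNorm γ φ + ε / (K + 1) := by positivity
  refine (hK φ hφ _ hpos fun z hz => (hle z hz).trans (by
    linarith [show 0 < ε / (K + 1) by positivity])).trans ?_
  calc _ ≤ (K + 1) * (RittCalc.supNorm γ φ + ε / (K + 1)) := by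
        gcongr
        linarith
    _ = _ := by
        rw [mul_add, mul_div_cancel₀]
        positivity
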